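/- A pair of half-pants is a hyperbolic annulus $P$ bounded by a closed geodesic $\gamma$ (the cuff) and by a geodesic loop $\zeta$ (the zipper) based at a point $C$ (the cone point); equivalently, one of the two pieces obtained by cutting a hyperbolic pair of pants having one cone-point boundary $C$ and two geodesic boundaries along the shortest essential geodesic arc $\zeta$ from $C$ to $C$. There are precisely two simple complete geodesic rays in $P$ that start at $C$ and come arbitrarily close to $\gamma$; by symmetry each makes the same angle at $C$ with the end of $\zeta$ nearest to it, and this angle is called the spiral-angle of $P$. The two spiral-angle regions at $C$ are the two closed sectors of directions at $C$ pointing into $P$ (including those tangent to $\zeta$) whose angle with one of the two ends of $\zeta$, measured inside $P$, is at most the spiral-angle. Lemma. Let $S$ be a hyperbolic surface without boundary, possibly with cone points, and let $P$ be a pair of half-pants isometrically embedded in $S$ as a closed subset (so that $P$ carries its own path metric, and $\gamma$ and $\zeta$ are included and embedded), such that $P$ contains no cone point of $S$ except possibly $C$. Let $\alpha$ be a geodesic ray in $S$ launched from $C$, in any direction, and prolonged as far as possible. Then the segment of $\alpha$ up to and including its first self-intersection (the whole of $\alpha$ if $\alpha$ is simple) lies entirely in $P$ if and only if $\alpha$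 is launched within one of the two spiral-angle regions of $P$ at $C$. -/

import Mathlib

open scoped UpperHalfPlane

/-! ## Hyperbolic surfaces with cone points -/

/-- `p` has a neighbourhood isometric to the hyperbolic cone of angle `θ`, with `p` at the apex:
the metric ball of some radius `ε` about `p` is swept out by polar coordinates `X r φ`, with
`0 ≤ r < ε` and `φ` in the circle `ℝ / θ ℤ`, in which the distance is that of an angle-`θ` wedge of
the hyperbolic plane with its two edges radially identified. (The norm on `AddCircle θ` is the
distance to `0` along the circle.) For `θ = 2 * π` this is a disc of the hyperbolic plane. -/
def HasConeAngle {S : Type*} [MetricSpace S] (p : S) (θ : ℝ) : Prop :=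
  0 < θ ∧ ∃ ε : ℝ, 0 < ε ∧ ∃ X : ℝ → AddCircle θ → S,
    (∀ φ : AddCircle θ, X 0 φ = p) ∧
    (∀ q ∈ Metric.ball p ε, ∃ r ∈ Set.Ico 0 ε, ∃ φ : AddCircle θ, X r φ = q) ∧
    (∀ r ∈ Set.Ico 0 ε, ∀ r₁ ∈ Set.Ico 0 ε, ∀ φ φ₁ : AddCircle θ,
      Real.cosh (dist (X r φ) (X r₁ φ₁)) =
        Real.cosh r * Real.cosh r₁
          - Real.sinh r * Real.sinh r₁ * Real.cos (min ‖φ - φ₁‖ Real.pi))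

/-- A hyperbolic surface without boundary, possibly with cone points: every point has some cone
angle. A point is a genuine cone point when its cone angle is not `2 * π`. -/
def IsHyperbolicConeSurface (S : Type*) [MetricSpace S] : Prop :=
  ∀ p : S, ∃ θ : ℝ, HasConeAngle p θ

/-- `α` is a (local, unit speed) geodesic on the set `I` of times. -/
def IsGeodesicOn {S : Type*} [MetricSpace S] (α : ℝ → S) (I : Set ℝ) : Prop :=
  ∀ t ∈ I, ∃ δ : ℝ, 0 < δ ∧ ∀ s ∈ I, ∀ u ∈ I, |s - t| < δ → |u - t| < δ →
    dist (α s) (α u) = |s - u|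

/-- `α`, with interval of definition `I ⊆ [0, ∞)`, is a geodesic ray launched from `p` at time `0`
and prolonged as far as possible: `I` is all of `[0, ∞)` unless the geodesic runs into a cone point
beyond which no geodesic continues it, or out of an incomplete surface. -/
structure IsGeodesicRayFrom {S : Type*} [MetricSpace S] (α : ℝ → S) (I : Set ℝ) (p : S) :
    Prop where
  ordConnected : I.OrdConnected
  zero_mem : 0 ∈ I
  nonneg : I ⊆ Set.Ici 0
  nontrivial : ∃ t ∈ I, 0 < t
  start : α 0 = p
  geodesic : IsGeodesicOn α I
  maximal : ∀ (β : ℝ → S) (J : Set ℝ), J.OrdConnected → J ⊆ Set.Ici 0 → I ⊆ J →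
    Set.EqOn α β I → IsGeodesicOn β J → J ⊆ I

/-- The segment of the ray `α` up to and including its first self-intersection: `α t` belongs to it
exactly when the ray has not met itself before time `t`. It is the whole ray if the ray is
simple. -/
def segmentToFirstSelfIntersection {S : Type*} (α : ℝ → S) (I : Set ℝ) : Set S :=
  {x | ∃ t ∈ I, Set.InjOn α (Set.Ico 0 t) ∧ α t = x}

/-! ## Hyperbolic plane -/

/-- The angle at `p` of the hyperbolic triangle `p x y` (for `x` and `y` different from `p`). -/
noncomputable def hypAngle (p x y : ℍ) : ℝ :=
  Real.arccos ((Real.cosh (dist p x) * Real.cosh (dist p y) - Real.cosh (dist x y)) /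
    (Real.sinh (dist p x) * Real.sinh (dist p y)))

/-- The geodesic of the upper half plane through `a` and `b` is the zero set of this function of
`z`; for `a.re < b.re` the function is positive outside the half-disc that the geodesic bounds. -/
noncomputable def sideOf (a b z : ℍ) : ℝ :=
  (b.re - a.re) * (Complex.normSq z - Complex.normSq a)
    - (z.re - a.re) * (Complex.normSq b - Complex.normSq a)

/-! ## Half-pants -/

/-- The data that determine a pair of half-pants, presented by its universal cover in the upper half
plane: the lift of the cuff is the imaginary axis, with deck transformations generated by the
translation `z ↦ exp (cuffLength) * z` along it, and `apex` is a lift of the cone point. -/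
structure HalfPants where
  cuffLength : ℝ
  cuffLength_pos : 0 < cuffLength
  apex : ℍ
  apex_re_pos : 0 < apex.re

namespace HalfPants

/-- The `n`-th power of the generating deck transformation. -/
noncomputable def deck (P : HalfPants) (n : ℤ) (z : ℍ) : ℍ :=
  (⟨Real.exp (n * P.cuffLength), Real.exp_pos _⟩ : {x : ℝ // 0 < x}) • z

theorem deck_re (P : HalfPants) (n : ℤ) (z : ℍ) :
    (P.deck n z).re = Real.exp (n * P.cuffLength) * z.re := by
  simp [deck]

theorem deck_im (P : HalfPants) (n : ℤ) (z : ℍ) :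
    (P.deck n z).im = Real.exp (n * P.cuffLength) * z.im := by
  simp [deck]

theorem deck_zero (P : HalfPants) (z : ℍ) : P.deck 0 z = z := by
  apply UpperHalfPlane.ext_re_im
  · simp [deck_re]
  · simp [deck_im]

theorem deck_deck (P : HalfPants) (m n : ℤ) (z : ℍ) :
    P.deck m (P.deck n z) = P.deck (m + n) z := by
  apply UpperHalfPlane.ext_re_im
  · simp only [deck_re]; push_cast; rw [add_mul, Real.exp_add, mul_assoc]
  · simp only [deck_im]; push_cast; rw [add_mul, Real.exp_add, mul_assoc]

/-- The universal cover of the half-pants: the closed region between the lift of the cuff (the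
imaginary axis) and the lift of the zipper (the broken geodesic through the successive translates of
the apex). The region is convex, so it is cut out by the geodesics that carry its sides. -/
def coverSet (P : HalfPants) : Set ℍ :=
  {z | 0 ≤ z.re ∧ ∀ n : ℤ, 0 ≤ sideOf (P.deck n P.apex) (P.deck (n + 1) P.apex) z}

/-- The universal cover of the half-pants, with the hyperbolic distance. -/
abbrev Cover (P : HalfPants) : Type := {z : ℍ // z ∈ P.coverSet}

/-- Two points of the cover are identified when a deck transformation takes one to the other. -/
instance setoid (P : HalfPants) : Setoid P.Cover where
  r z w := ∃ n : ℤ, (w : ℍ) = P.deck n z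
  iseqv :=
    { refl := fun z => ⟨0, (P.deck_zero z).symm⟩
      symm := by
        rintro z w ⟨n, hn⟩
        exact ⟨-n, by rw [hn, deck_deck, neg_add_cancel, deck_zero]⟩
      trans := by
        rintro x y z ⟨m, hm⟩ ⟨n, hn⟩
        exact ⟨n + m, by rw [hn, hm, deck_deck]⟩ }

/-- The half-pants itself: an annulus bounded by the cuff and by the zipper. Equivalently, a
quadrilateral with base on the cuff line, two equal legs perpendicular to it and the zipper as its
summit, with its legs glued together. -/
def Carrier (P : HalfPants) : Type := Quotient P.setoid

/-- The covering projection. -/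
def proj (P : HalfPants) (z : P.Cover) : P.Carrier := Quotient.mk P.setoid z

theorem apex_mem (P : HalfPants) : P.apex ∈ P.coverSet := by
  refine ⟨P.apex_re_pos.le, fun n => ?_⟩
  have hl := P.cuffLength_pos
  have ha := P.apex_re_pos
  have key : sideOf (P.deck n P.apex) (P.deck (n + 1) P.apex) P.apex =
      P.apex.re * (P.apex.re ^ 2 + P.apex.im ^ 2) *
        (Real.exp ((n + 1 : ℤ) * P.cuffLength) - Real.exp (n * P.cuffLength)) *
        ((Real.exp (n * P.cuffLength) - 1) * (Real.exp ((n + 1 : ℤ) * P.cuffLength) - 1)) := by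
    simp only [sideOf, Complex.normSq_apply, UpperHalfPlane.coe_re, UpperHalfPlane.coe_im,
      deck_re, deck_im]
    ring
  rw [key]
  have h1 : Real.exp (n * P.cuffLength) ≤ Real.exp ((n + 1 : ℤ) * P.cuffLength) := by
    apply Real.exp_le_exp.2
    push_cast
    nlinarith
  have h2 : 0 ≤ (Real.exp (n * P.cuffLength) - 1) *
      (Real.exp ((n + 1 : ℤ) * P.cuffLength) - 1) := by
    rcases le_or_gt 0 n with hn | hn
    · have hn1 : (0 : ℝ) ≤ n := by exact_mod_cast hn
      have : 1 ≤ Real.exp (n * P.cuffLength) := Real.one_le_exp (by positivity)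
      exact mul_nonneg (by linarith) (by linarith)
    · have hn1 : ((n + 1 : ℤ) : ℝ) ≤ 0 := by exact_mod_cast hn
      have : Real.exp ((n + 1 : ℤ) * P.cuffLength) ≤ 1 :=
        Real.exp_le_one_iff.2 (mul_nonpos_of_nonpos_of_nonneg hn1 hl.le)
      exact mul_nonneg_of_nonpos_of_nonpos (by linarith) (by linarith)
  have h3 : 0 ≤ P.apex.re * (P.apex.re ^ 2 + P.apex.im ^ 2) := by positivity
  exact mul_nonneg (mul_nonneg h3 (by linarith)) h2

/-- The chosen lift of the cone point, as a point of the cover. -/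
def apexLift (P : HalfPants) : P.Cover := ⟨P.apex, P.apex_mem⟩

/-- The cone point `C` of the half-pants. -/
def conePoint (P : HalfPants) : P.Carrier := P.proj P.apexLift

/-- `r` lifts one of the simple complete geodesic rays of the half-pants that start at `C` and
spiral arbitrarily close to the cuff. -/
structure IsSpiralRay (P : HalfPants) (r : ℝ → P.Cover) : Prop where
  start : r 0 = P.apexLift
  geodesic : ∀ s t : ℝ, 0 ≤ s → 0 ≤ t → dist (r s) (r t) = |s - t|
  simple : Set.InjOn (fun t => P.proj (r t)) (Set.Ici 0)
  spirals : ∀ ε : ℝ, 0 < ε → ∃ t : ℝ, 0 ≤ t ∧ ∃ g : ℍ, g.re = 0 ∧ dist (r t : ℍ) g < ε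

/-- The angle at `C` between the zipper and the geodesic from the apex to `z`, measured inside the
half-pants from whichever of the two ends of the zipper at `C` is nearer. The two ends lift to the
geodesics from the apex to its two neighbouring translates. -/
noncomputable def zipperAngle (P : HalfPants) (z : ℍ) : ℝ :=
  min (hypAngle P.apex (P.deck 1 P.apex) z) (hypAngle P.apex (P.deck (-1) P.apex) z)

/-- `σ` is the spiral-angle: the angle at `C` between the zipper and a spiralling ray. -/
def IsSpiralAngle (P : HalfPants) (σ : ℝ) : Prop :=
  ∃ r : ℝ → P.Cover, P.IsSpiralRay r ∧ σ = P.zipperAngle (r 1)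

/-- `ι` embeds the (closed) half-pants isometrically in `S`: it is injective, it preserves the
distance of nearby points away from `C` and the distance to `C` near `C`, and the image has no cone
point of `S` other than, possibly, the image of `C`. (Near `C` only distances to `C` are compared,
since two points on either side of `C` may be joined by a short-cut outside the half-pants.) -/
structure IsEmbedding (P : HalfPants) {S : Type*} [MetricSpace S] (ι : P.Carrier → S) :
    Prop where
  injective : Function.Injective ι
  isometric : ∀ z : P.Cover, P.proj z ≠ P.conePoint → ∃ ε : ℝ, 0 < ε ∧
    ∀ u ∈ Metric.ball z ε, ∀ v ∈ Metric.ball z ε,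
      dist (ι (P.proj u)) (ι (P.proj v)) = dist u v
  isometric_conePoint : ∃ ε : ℝ, 0 < ε ∧ ∀ u ∈ Metric.ball P.apexLift ε,
      dist (ι P.conePoint) (ι (P.proj u)) = dist P.apexLift u
  regular : ∀ x : P.Carrier, x ≠ P.conePoint → HasConeAngle (ι x) (2 * Real.pi)

/-- The ray `α` in `S` is launched from `C` within one of the two spiral-angle regions: it starts
out along the image of a geodesic of the half-pants that makes with the zipper an angle at most the
spiral-angle. -/
def LaunchedWithinSpiralAngle (P : HalfPants) {S : Type*} (ι : P.Carrier → S)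
    (α : ℝ → S) (I : Set ℝ) : Prop :=
  ∃ δ : ℝ, 0 < δ ∧ Set.Icc 0 δ ⊆ I ∧ ∃ β : ℝ → P.Cover,
    β 0 = P.apexLift ∧
    (∀ s ∈ Set.Icc 0 δ, ∀ t ∈ Set.Icc 0 δ, dist (β s) (β t) = |s - t|) ∧
    (∀ s ∈ Set.Icc 0 δ, α s = ι (P.proj (β s))) ∧
    ∃ σ : ℝ, P.IsSpiralAngle σ ∧ P.zipperAngle (β δ) ≤ σ

end HalfPants

/-!
The hyperbolic plane is put on the hyperboloid `U V - W ^ 2 = 1`, where deck transformations act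
diagonally (`U` is multiplied by `k`, `V` by `k⁻¹`, and `W` is fixed), `W` is the hyperbolic sine of
the signed distance to the lifted cuff, geodesics are the curves `cosh t • A + sinh t • E`, and the
half-planes that cut out the cover are given by linear inequalities. A direction at the apex is a
unit vector `(p, r)`, with `r` the component pointing away from the cuff. Along the geodesic in this
direction `W` equals `apexW * cosh t + r * apexC * sinh t`, so the sign of `apexW + r * apexC`
decides everything:

* If it is negative, the geodesic reaches the cuff, staying in the cover until then, and `W`
  decreases strictly on the way; since `W` is invariant under the deck group, the projected ray is
  simple up to the cuff (`exists_ray_hits_cuff`). The cuff consists of regular points, so a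
  maximal geodesic continues across it, and leaves the half-pants before meeting itself
  (`not_segment_subset_of_hits_cuff`).
* If it is zero, the geodesic is a spiral ray, which stays in the cover forever
  (`exists_isSpiralRay`, `ray_mem_of_spiral`).
* If it is positive and the direction points into the half-pants, the geodesic is a chord of the
  equidistant curve through the apex, and it meets one of its translates while still in the cover
  (`exists_self_intersection`).

The angle with the nearer end of the zipper is a decreasing function of `r` on the directions that
point into the half-pants (`zipperAngle_ray_le_iff`), so the last two cases are exactly the
directions within the spiral-angle.

To transfer this to the surface, a geodesic that stays for a moment in the half-pants is lifted to a
ray from the apex (`exists_ray_lift`), which uses that nearby points of the embedded half-pants have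
nearby lifts (`exists_deck_dist_lt`, by compactness). From then on it follows the image of that
ray, because geodesics have unique continuations through points of cone angle `2 * π`
(`HasConeAngle.exists_unique_continuation`, `eqOn_toSurface_ray`).
-/

namespace HalfPants

/-! ### Hyperboloid coordinates -/

/-- The Euclidean modulus of the apex, the unit of length of the coordinates. -/
noncomputable def modulus (P : HalfPants) : ℝ := √(P.apex.re ^ 2 + P.apex.im ^ 2)

/-- First light-cone coordinate on the hyperboloid `U V - W ^ 2 = 1`; deck transformations
multiply it by a positive constant. It is normalised to agree with `coordV` at the apex. -/
noncomputable def coordU (P : HalfPants) (z : ℍ) : ℝ :=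
  (z.re ^ 2 + z.im ^ 2) / (P.modulus * z.im)

/-- Second light-cone coordinate on the hyperboloid `U V - W ^ 2 = 1`. -/
noncomputable def coordV (P : HalfPants) (z : ℍ) : ℝ := P.modulus / z.im

/-- Third coordinate on the hyperboloid `U V - W ^ 2 = 1`: the hyperbolic sine of the signed
distance to the imaginary axis. It is invariant under deck transformations. -/
noncomputable def coordW (z : ℍ) : ℝ := z.re / z.im

/-- The common value of `coordU` and `coordV` at the apex. -/
noncomputable def apexC (P : HalfPants) : ℝ := P.modulus / P.apex.im

/-- The value of `coordW` at the apex. -/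
noncomputable def apexW (P : HalfPants) : ℝ := P.apex.re / P.apex.im

/-- The dilation factor of the generating deck transformation. -/
noncomputable def factor (P : HalfPants) : ℝ := Real.exp P.cuffLength

variable (P : HalfPants)

theorem modulus_pos : 0 < P.modulus :=
  Real.sqrt_pos.2 (by have := P.apex.im_pos; positivity)

theorem modulus_sq : P.modulus ^ 2 = P.apex.re ^ 2 + P.apex.im ^ 2 :=
  Real.sq_sqrt (by positivity)

theorem apexC_pos : 0 < P.apexC := div_pos P.modulus_pos P.apex.im_pos

theorem apexW_pos : 0 < P.apexW := div_pos P.apex_re_pos P.apex.im_pos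

theorem apexC_sq : P.apexC ^ 2 = 1 + P.apexW ^ 2 := by
  have h := P.apex.im_pos.ne'
  rw [apexC, apexW, div_pow, modulus_sq]
  field_simp
  ring

theorem apexW_lt_apexC : P.apexW < P.apexC := by
  nlinarith [P.apexC_sq, P.apexC_pos, P.apexW_pos]

theorem one_lt_factor : 1 < P.factor := Real.one_lt_exp_iff.2 P.cuffLength_pos

theorem factor_pos : 0 < P.factor := Real.exp_pos _

theorem exp_int_mul_cuffLength (n : ℤ) : Real.exp (n * P.cuffLength) = P.factor ^ n  := by
  rw [mul_comm, Real.exp_mul, Real.rpow_intCast, factor]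

@[simp] theorem coordV_apex : P.coordV P.apex = P.apexC := rfl

@[simp] theorem coordW_apex : coordW P.apex = P.apexW := rfl

@[simp] theorem coordU_apex : P.coordU P.apex = P.apexC := by
  have h := P.apex.im_pos.ne'
  have h' := P.modulus_pos.ne'
  rw [coordU, apexC, ← modulus_sq]
  field_simp

theorem coordV_pos (z : ℍ) : 0 < P.coordV z := div_pos P.modulus_pos z.im_pos

theorem coordU_mul_coordV (z : ℍ) : P.coordU z * P.coordV z = 1 + coordW z ^ 2 := by
  have h := z.im_pos.ne'
  have h' := P.modulus_pos.ne'
  rw [coordU, coordV, coordW]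
  field_simp
  ring

theorem coordU_pos (z : ℍ) : 0 < P.coordU z := by
  have h := P.coordU_mul_coordV z
  exact pos_of_mul_pos_left (b := P.coordV z) (by rw [h]; positivity) (P.coordV_pos z).le

theorem ext_coord {z z' : ℍ} (hV : P.coordV z = P.coordV z') (hW : coordW z = coordW z') :
    z = z' := by
  have h := P.modulus_pos.ne'
  have h1 := z.im_pos.ne'
  have h2 := z'.im_pos.ne'
  rw [coordV, coordV] at hV
  have him : z.im = z'.im := by field_simp at hV; exact hV.symm
  rw [coordW, coordW, him] at hW
  exact UpperHalfPlane.ext_re_im (by field_simp at hW; exact hW) him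

theorem cosh_dist_eq (z z' : ℍ) : Real.cosh (dist z z') =
    (P.coordU z * P.coordV z' + P.coordV z * P.coordU z') / 2 - coordW z * coordW z' := by
  have h := P.modulus_pos.ne'
  have h1 := z.im_pos.ne'
  have h2 := z'.im_pos.ne'
  rw [UpperHalfPlane.cosh_dist, Complex.dist_eq, ← Complex.normSq_eq_norm_sq,
    Complex.normSq_apply]
  simp only [Complex.sub_re, Complex.sub_im, UpperHalfPlane.coe_re, UpperHalfPlane.coe_im,
    coordU, coordV, coordW]
  field_simp
  ring

/-- The point of the upper half plane with given coordinates `V` and `W`. -/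
noncomputable def ofCoord (v w : ℝ) (hv : 0 < v) : ℍ :=
  ⟨⟨P.modulus * w / v, P.modulus / v⟩, div_pos P.modulus_pos hv⟩

theorem coordV_ofCoord (v w : ℝ) (hv : 0 < v) : P.coordV (P.ofCoord v w hv) = v := by
  have h := P.modulus_pos.ne'
  change P.modulus / (P.modulus / v) = v
  field_simp

theorem coordW_ofCoord (v w : ℝ) (hv : 0 < v) : coordW (P.ofCoord v w hv) = w := by
  have h := P.modulus_pos.ne'
  change P.modulus * w / v / (P.modulus / v) = w
  field_simp

theorem coordU_deck (n : ℤ) (z : ℍ) : P.coordU (P.deck n z) = P.factor ^ n * P.coordU z := by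
  have h := P.modulus_pos.ne'
  have h1 := z.im_pos.ne'
  have h2 : P.factor ^ n ≠ 0 := (zpow_pos P.factor_pos n).ne'
  rw [coordU, coordU, deck_re, deck_im, exp_int_mul_cuffLength]
  field_simp

theorem coordV_deck (n : ℤ) (z : ℍ) : P.coordV (P.deck n z) = P.coordV z / P.factor ^ n := by
  have h1 := z.im_pos.ne'
  have h2 : P.factor ^ n ≠ 0 := (zpow_pos P.factor_pos n).ne'
  rw [coordV, coordV, deck_im, exp_int_mul_cuffLength]
  field_simp

theorem coordW_deck (n : ℤ) (z : ℍ) : coordW (P.deck n z) = coordW z := by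
  have h1 := z.im_pos.ne'
  have h2 : P.factor ^ n ≠ 0 := (zpow_pos P.factor_pos n).ne'
  rw [coordW, coordW, deck_re, deck_im, exp_int_mul_cuffLength]
  field_simp

/-- In hyperboloid coordinates the half-planes that cut out the cover are given by linear
inequalities. -/
theorem mem_coverSet_iff (z : ℍ) : z ∈ P.coverSet ↔ 0 ≤ coordW z ∧ ∀ n : ℤ,
    (P.factor ^ n + P.factor ^ (n + 1)) * P.apexC * coordW z ≤
      P.apexW * (P.coordU z + P.factor ^ n * P.factor ^ (n + 1) * P.coordV z) := by
  have hN := P.modulus_pos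
  have hz := z.im_pos
  have hA := P.apex.im_pos
  have hq := P.one_lt_factor
  refine and_congr ?_ (forall_congr' fun n => ?_)
  · rw [coordW, le_div_iff₀ hz, zero_mul]
  · have hk := zpow_pos P.factor_pos n
    have hk' : P.factor ^ (n + 1) = P.factor ^ n * P.factor :=
      zpow_add_one₀ P.factor_pos.ne' n
    have key : sideOf (P.deck n P.apex) (P.deck (n + 1) P.apex) z =
        (P.factor ^ (n + 1) - P.factor ^ n) * (z.im * P.apex.im * P.modulus) *
        (P.apexW * (P.coordU z + P.factor ^ n * P.factor ^ (n + 1) * P.coordV z) -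
          (P.factor ^ n + P.factor ^ (n + 1)) * P.apexC * coordW z) := by
      have h2 := P.modulus_sq
      simp only [sideOf, Complex.normSq_apply, UpperHalfPlane.coe_re, UpperHalfPlane.coe_im,
        deck_re, deck_im, exp_int_mul_cuffLength, apexW, apexC, coordU, coordV, coordW]
      generalize P.factor ^ n = k
      generalize P.factor ^ (n + 1) = k'
      field_simp
      rw [h2]
      ring
    rw [key, mul_nonneg_iff_of_pos_left, sub_nonneg]
    have : 0 < P.factor ^ (n + 1) - P.factor ^ n := by rw [hk']; nlinarith
    positivity

/-- If `y` lies between `x` and `z` on a geodesic, its coordinate vector is the corresponding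
combination of those of `x` and `z`: the difference of the two sides is orthogonal to the timelike
vector of `y` and is null, so it vanishes. -/
theorem coord_between {x y z : ℍ} {a b : ℝ} (hxy : dist x y = a) (hyz : dist y z = b)
    (hxz : dist x z = a + b) :
    Real.sinh (a + b) * P.coordU y = Real.sinh b * P.coordU x + Real.sinh a * P.coordU z ∧
    Real.sinh (a + b) * P.coordV y = Real.sinh b * P.coordV x + Real.sinh a * P.coordV z ∧
    Real.sinh (a + b) * coordW y = Real.sinh b * coordW x + Real.sinh a * coordW z := by
  have h1 := P.cosh_dist_eq x y
  have h2 := P.cosh_dist_eq y z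
  have h3 := P.cosh_dist_eq x z
  rw [hxy] at h1
  rw [hyz] at h2
  rw [hxz, Real.cosh_add] at h3
  rw [Real.sinh_add]
  have ha := Real.cosh_sq a
  have hb := Real.cosh_sq b
  have hx := P.coordU_mul_coordV x
  have hy := P.coordU_mul_coordV y
  have hz := P.coordU_mul_coordV z
  have hVy := P.coordV_pos y
  generalize P.coordU x = ux at *
  generalize P.coordU y = uy at *
  generalize P.coordU z = uz at *
  generalize P.coordV x = vx at *
  generalize P.coordV y = vy at *
  generalize P.coordV z = vz at *
  generalize coordW x = wx at *
  generalize coordW y = wy at *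
  generalize coordW z = wz at *
  generalize Real.cosh a = ca at *
  generalize Real.cosh b = cb at *
  generalize Real.sinh a = sa at *
  generalize Real.sinh b = sb at *
  obtain ⟨du, hdu⟩ : ∃ du, du = (sa * cb + ca * sb) * uy - (sb * ux + sa * uz) := ⟨_, rfl⟩
  obtain ⟨dv, hdv⟩ : ∃ dv, dv = (sa * cb + ca * sb) * vy - (sb * vx + sa * vz) := ⟨_, rfl⟩
  obtain ⟨dw, hdw⟩ : ∃ dw, dw = (sa * cb + ca * sb) * wy - (sb * wx + sa * wz) := ⟨_, rfl⟩
  have e1 : (du * vy + dv * uy) / 2 - dw * wy = 0 := by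
    subst hdu hdv hdw
    linear_combination (sa * cb + ca * sb) * hy + sb * h1 + sa * h2
  have e2 : du * dv - dw ^ 2 = 0 := by
    have e3 : du * dv - dw ^ 2 = - sb * ((dv * ux + du * vx) / 2 - dw * wx)
        - sa * ((dv * uz + du * vz) / 2 - dw * wz) := by
      linear_combination (sa * cb + ca * sb) * e1 + (dv / 2) * hdu + (du / 2) * hdv - dw * hdw
    have e4 : (dv * ux + du * vx) / 2 - dw * wx = 0 := by
      subst hdu hdv hdw
      linear_combination -(sa * cb + ca * sb) * h1 - sb * hx + sa * h3 + sb * ha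
    have e5 : (dv * uz + du * vz) / 2 - dw * wz = 0 := by
      subst hdu hdv hdw
      linear_combination -(sa * cb + ca * sb) * h2 - sa * hz + sb * h3 + sa * hb
    rw [e3, e4, e5]; ring
  have e6 : (dv * wy - dw * vy) ^ 2 + dv ^ 2 = 0 := by
    linear_combination dv ^ 2 * hy * (-1) - vy ^ 2 * e2 + 2 * vy * dv * e1
  have hdv0 : dv = 0 := by nlinarith [sq_nonneg (dv * wy - dw * vy), sq_nonneg dv]
  have hdw0 : dw = 0 := by
    rw [hdv0] at e6
    have : (dw * vy) ^ 2 = 0 := by linarith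
    have := pow_eq_zero_iff (two_ne_zero) |>.1 this
    rcases mul_eq_zero.1 this with h | h
    · exact h
    · exact absurd h hVy.ne'
  have hdu0 : du = 0 := by
    rw [hdv0, hdw0] at e1
    have : du * vy = 0 := by linarith
    exact (mul_eq_zero.1 this).resolve_right hVy.ne'
  exact ⟨by linarith, by linarith, by linarith⟩

end HalfPants

namespace HalfPants
variable (P : HalfPants)

/-! ### Geodesics from the apex -/

theorem abs_slope_le {p r : ℝ} (h : p ^ 2 + r ^ 2 = 1) : |-p + r * P.apexW| ≤ P.apexC := by
  refine abs_le_of_sq_le_sq ?_ P.apexC_pos.le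
  rw [P.apexC_sq]
  have : (-p + r * P.apexW) ^ 2 + (p * P.apexW + r) ^ 2 = 1 + P.apexW ^ 2 := by
    linear_combination (1 + P.apexW ^ 2) * h
  nlinarith [sq_nonneg (p * P.apexW + r)]

theorem coordV_ray_pos {p r : ℝ} (h : p ^ 2 + r ^ 2 = 1) (t : ℝ) :
    0 < Real.cosh t * P.apexC + Real.sinh t * (-p + r * P.apexW) := by
  have h1 := P.abs_slope_le h
  have h2 : |Real.sinh t| < Real.cosh t := by
    refine abs_lt_of_sq_lt_sq ?_ (Real.cosh_pos t).le
    rw [Real.cosh_sq]; linarith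
  have h3 : |Real.sinh t * (-p + r * P.apexW)| < Real.cosh t * P.apexC := by
    rw [abs_mul]
    exact mul_lt_mul_of_lt_of_le_of_nonneg_of_pos h2 h1 (abs_nonneg _) P.apexC_pos
  linarith [neg_abs_le (Real.sinh t * (-p + r * P.apexW))]

/-- The unit speed geodesic through the apex at time `0`, in the direction that has components
`p` along the equidistant curve through the apex (towards the image of the apex under the
generating deck transformation) and `r` perpendicular to it (away from the cuff). -/
noncomputable def ray {p r : ℝ} (h : p ^ 2 + r ^ 2 = 1) (t : ℝ) : ℍ :=
  P.ofCoord (Real.cosh t * P.apexC + Real.sinh t * (-p + r * P.apexW))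
    (Real.cosh t * P.apexW + Real.sinh t * (r * P.apexC)) (P.coordV_ray_pos h t)

variable {p r p' r' : ℝ} (h : p ^ 2 + r ^ 2 = 1) (h' : p' ^ 2 + r' ^ 2 = 1)

theorem coordV_ray (t : ℝ) : P.coordV (P.ray h t) =
    Real.cosh t * P.apexC + Real.sinh t * (-p + r * P.apexW) := P.coordV_ofCoord ..

theorem coordW_ray (t : ℝ) : coordW (P.ray h t) =
    Real.cosh t * P.apexW + Real.sinh t * (r * P.apexC) := P.coordW_ofCoord ..

theorem coordU_ray (t : ℝ) : P.coordU (P.ray h t) =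
    Real.cosh t * P.apexC + Real.sinh t * (p + r * P.apexW) := by
  have h1 := P.coordU_mul_coordV (P.ray h t)
  refine mul_right_cancel₀ (P.coordV_pos (P.ray h t)).ne' (h1.trans ?_)
  rw [coordV_ray, coordW_ray]
  linear_combination (-1 + Real.sinh t ^ 2 * (r ^ 2 - 1)) * P.apexC_sq
    + (- P.apexC ^ 2 + P.apexW ^ 2) * Real.cosh_sq t + Real.sinh t ^ 2 * h

@[simp] theorem ray_zero : P.ray h 0 = P.apex :=
  P.ext_coord (by simp [coordV_ray]) (by simp [coordW_ray])

theorem cosh_dist_ray_ray (s t : ℝ) : Real.cosh (dist (P.ray h s) (P.ray h' t)) =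
    Real.cosh s * Real.cosh t - Real.sinh s * Real.sinh t * (p * p' + r * r') := by
  rw [P.cosh_dist_eq]
  simp only [coordU_ray, coordV_ray, coordW_ray]
  linear_combination (Real.cosh s * Real.cosh t - Real.sinh s * Real.sinh t * (r * r')) *
    P.apexC_sq

theorem eq_of_cosh_eq_cosh {a b : ℝ} (ha : 0 ≤ a) (hb : 0 ≤ b)
    (hab : Real.cosh a = Real.cosh b) : a = b := by
  have h1 := Real.cosh_le_cosh.1 hab.le
  have h2 := Real.cosh_le_cosh.1 hab.ge
  rw [abs_of_nonneg ha, abs_of_nonneg hb] at h1 h2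
  exact le_antisymm h1 h2

theorem dist_ray (s t : ℝ) : dist (P.ray h s) (P.ray h t) = |s - t| := by
  refine eq_of_cosh_eq_cosh dist_nonneg (abs_nonneg _) ?_
  rw [cosh_dist_ray_ray, Real.cosh_abs, Real.cosh_sub]
  linear_combination (- Real.sinh s * Real.sinh t) * h

theorem continuous_ray : Continuous (P.ray h) :=
  (Isometry.of_dist_eq fun s t => (P.dist_ray h s t).trans (Real.dist_eq s t).symm).continuous

theorem ray_neg_slope (t : ℝ) (hn : (-p) ^ 2 + r ^ 2 = 1) :
    P.coordU (P.ray h t) = P.coordV (P.ray hn t) ∧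
      P.coordV (P.ray h t) = P.coordU (P.ray hn t) := by
  simp only [coordU_ray, coordV_ray, neg_neg, and_self]

/-- Every point lies on a geodesic from the apex. -/
theorem exists_ray_eq {z : ℍ} (hz : z ≠ P.apex) :
    ∃ (p r : ℝ) (h : p ^ 2 + r ^ 2 = 1), z = P.ray h (dist P.apex z) := by
  have hd : 0 < Real.sinh (dist P.apex z) := Real.sinh_pos_iff.2 (dist_pos.2 hz.symm)
  have h1 := P.cosh_dist_eq P.apex z
  have h2 := P.coordU_mul_coordV z
  have h3 := Real.cosh_sq (dist P.apex z)
  have hc := P.apexC_pos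
  have hcw := P.apexC_sq
  simp only [coordU_apex, coordV_apex, coordW_apex] at h1
  set d := dist P.apex z
  obtain ⟨u, hu⟩ : ∃ u, P.coordU z = Real.cosh d * P.apexC + Real.sinh d * u :=
    ⟨(P.coordU z - Real.cosh d * P.apexC) / Real.sinh d, by field_simp; ring⟩
  obtain ⟨v, hv⟩ : ∃ v, P.coordV z = Real.cosh d * P.apexC + Real.sinh d * v :=
    ⟨(P.coordV z - Real.cosh d * P.apexC) / Real.sinh d, by field_simp; ring⟩
  obtain ⟨r, hr⟩ : ∃ r, coordW z = Real.cosh d * P.apexW + Real.sinh d * (r * P.apexC) :=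
    ⟨(coordW z - Real.cosh d * P.apexW) / Real.sinh d / P.apexC, by field_simp; ring⟩
  rw [hu, hv, hr] at h1 h2
  -- the direction is orthogonal to the vector of the apex and has norm `-1`
  have e1 : u + v = 2 * r * P.apexW := by
    have : Real.sinh d * P.apexC * (u + v - 2 * r * P.apexW) = 0 := by
      linear_combination -2 * h1 - 2 * Real.cosh d * hcw
    have := (mul_eq_zero.1 this).resolve_left (mul_pos hd hc).ne'
    linarith
  have e2 : u * v - (r * P.apexC) ^ 2 = -1 := by
    have : Real.sinh d ^ 2 * (u * v - (r * P.apexC) ^ 2 + 1) = 0 := by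
      linear_combination h2 - Real.cosh d * Real.sinh d * P.apexC * e1
        - Real.cosh d ^ 2 * hcw - h3
    have := (mul_eq_zero.1 this).resolve_left (pow_pos hd 2).ne'
    linarith
  refine ⟨(u - v) / 2, r, ?_, P.ext_coord ?_ ?_⟩
  · linear_combination -e2 - r ^ 2 * hcw + (u + v + 2 * r * P.apexW) / 4 * e1
  · rw [coordV_ray, hv]
    linear_combination Real.sinh d / 2 * e1
  · rw [coordW_ray, hr]

/-- A geodesic that starts at the apex is a `ray`. -/
theorem exists_eqOn_ray {β : ℝ → ℍ} {δ : ℝ} (hδ : 0 < δ) (h0 : β 0 = P.apex)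
    (hβ : ∀ s ∈ Set.Icc 0 δ, ∀ t ∈ Set.Icc 0 δ, dist (β s) (β t) = |s - t|) :
    ∃ (p r : ℝ) (h : p ^ 2 + r ^ 2 = 1), Set.EqOn β (P.ray h) (Set.Icc 0 δ) := by
  have m0 : (0 : ℝ) ∈ Set.Icc 0 δ := ⟨le_rfl, hδ.le⟩
  have m1 : δ ∈ Set.Icc 0 δ := ⟨hδ.le, le_rfl⟩
  have hd : dist P.apex (β δ) = δ := by
    rw [← h0, hβ 0 m0 δ m1, zero_sub, abs_neg, abs_of_pos hδ]
  obtain ⟨p, r, h, hz⟩ := P.exists_ray_eq (z := β δ) (by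
    intro e; rw [e, dist_self] at hd; exact hδ.ne hd)
  rw [hd] at hz
  refine ⟨p, r, h, fun s hs => ?_⟩
  have a1 : dist (β 0) (β s) = s := by
    rw [hβ 0 m0 s hs, zero_sub, abs_neg, abs_of_nonneg hs.1]
  have a2 : dist (β s) (β δ) = δ - s := by
    rw [hβ s hs δ m1, abs_sub_comm, abs_of_nonneg (sub_nonneg.2 hs.2)]
  have b1 : dist (P.ray h 0) (P.ray h s) = s := by
    rw [dist_ray, zero_sub, abs_neg, abs_of_nonneg hs.1]
  have b2 : dist (P.ray h s) (P.ray h δ) = δ - s := by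
    rw [dist_ray, abs_sub_comm, abs_of_nonneg (sub_nonneg.2 hs.2)]
  have c1 := P.coord_between a1 a2 (by rw [h0, hd]; ring)
  have c2 := P.coord_between b1 b2 (by rw [dist_ray, zero_sub, abs_neg, abs_of_pos hδ]; ring)
  rw [ray_zero, ← h0, ← hz] at c2
  have hs : Real.sinh (s + (δ - s)) ≠ 0 := by
    rw [add_sub_cancel]; exact (Real.sinh_pos_iff.2 hδ).ne'
  exact P.ext_coord (mul_left_cancel₀ hs (c1.2.1.trans c2.2.1.symm))
    (mul_left_cancel₀ hs (c1.2.2.trans c2.2.2.symm))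

/-- The cover is convex. -/
theorem mem_coverSet_of_between {x y z : ℍ} {a b : ℝ} (ha : 0 ≤ a) (hb : 0 ≤ b) (hab : 0 < a + b)
    (hxy : dist x y = a) (hyz : dist y z = b) (hxz : dist x z = a + b) (hx : x ∈ P.coverSet)
    (hz : z ∈ P.coverSet) : y ∈ P.coverSet := by
  obtain ⟨e1, e2, e3⟩ := P.coord_between hxy hyz hxz
  rw [mem_coverSet_iff] at hx hz ⊢
  have ha' := Real.sinh_nonneg_iff.2 ha
  have hb' := Real.sinh_nonneg_iff.2 hb
  have hab' := Real.sinh_pos_iff.2 hab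
  refine ⟨?_, fun n => ?_⟩
  · refine nonneg_of_mul_nonneg_right (a := Real.sinh (a + b)) ?_ hab'
    rw [e3]
    exact add_nonneg (mul_nonneg hb' hx.1) (mul_nonneg ha' hz.1)
  · refine le_of_mul_le_mul_left ?_ hab'
    have h1 := mul_le_mul_of_nonneg_left (hx.2 n) hb'
    have h2 := mul_le_mul_of_nonneg_left (hz.2 n) ha'
    generalize P.factor ^ n = k at *
    generalize P.factor ^ (n + 1) = k' at *
    linear_combination h1 + h2 - P.apexW * e1 - P.apexW * k * k' * e2 + (k + k') * P.apexC * e3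

theorem ray_mem_coverSet {s t : ℝ} (hs : 0 ≤ s) (hst : s ≤ t) (ht : P.ray h t ∈ P.coverSet) :
    P.ray h s ∈ P.coverSet := by
  rcases hs.eq_or_lt with rfl | hs
  · rw [ray_zero]; exact P.apex_mem
  refine P.mem_coverSet_of_between (a := s) (b := t - s) hs.le (sub_nonneg.2 hst) (by linarith)
    ?_ ?_ ?_ P.apex_mem ht
  · rw [← P.ray_zero h, dist_ray, zero_sub, abs_neg, abs_of_pos hs]
  · rw [dist_ray, abs_sub_comm, abs_of_nonneg (sub_nonneg.2 hst)]
  · rw [← P.ray_zero h, dist_ray, zero_sub, abs_neg, abs_of_pos (by linarith)]; ring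

end HalfPants

namespace HalfPants
variable (P : HalfPants)

/-! ### Spiral rays and the spiral-angle -/

theorem coverSet_deck {z : ℍ} (hz : z ∈ P.coverSet) (m : ℤ) : P.deck m z ∈ P.coverSet := by
  rw [mem_coverSet_iff] at hz ⊢
  refine ⟨by rw [coordW_deck]; exact hz.1, fun n => ?_⟩
  have h1 := hz.2 (n - m)
  have hq := P.factor_pos
  have hk : 0 < P.factor ^ m := zpow_pos hq m
  have e1 : P.factor ^ n = P.factor ^ m * P.factor ^ (n - m) := by
    rw [← zpow_add₀ hq.ne']; congr 1; ring
  have e2 : P.factor ^ (n + 1) = P.factor ^ m * P.factor ^ (n - m + 1) := by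
    rw [← zpow_add₀ hq.ne']; congr 1; ring
  rw [coordU_deck, coordV_deck, coordW_deck, e1, e2]
  generalize P.factor ^ (n - m) = k at *
  generalize P.factor ^ (n - m + 1) = k' at *
  generalize P.factor ^ m = K at *
  have e3 : K * k * (K * k') * (P.coordV z / K) = K * (k * k' * P.coordV z) := by
    field_simp
  rw [e3]
  linear_combination K * h1

/-- The cover is invariant under the reflection in the perpendicular from the apex to the cuff,
which exchanges the coordinates `U` and `V`. -/
theorem coverSet_congr_swap {z z' : ℍ} (hU : P.coordU z = P.coordV z')
    (hV : P.coordV z = P.coordU z') (hW : coordW z = coordW z') (hz : z ∈ P.coverSet) :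
    z' ∈ P.coverSet := by
  rw [mem_coverSet_iff, hU, hV, hW] at hz
  rw [mem_coverSet_iff]
  refine ⟨hz.1, fun n => ?_⟩
  have h1 := hz.2 (-(n + 1))
  have hq := P.factor_pos
  have hk : 0 < P.factor ^ n := zpow_pos hq n
  have hk' : 0 < P.factor ^ (n + 1) := zpow_pos hq (n + 1)
  rw [show -(n + 1) + 1 = -n by ring, zpow_neg, zpow_neg] at h1
  generalize P.factor ^ n = k at *
  generalize P.factor ^ (n + 1) = k' at *
  have h2 := mul_le_mul_of_nonneg_left h1 (mul_pos hk hk').le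
  have e1 : k * k' * ((k'⁻¹ + k⁻¹) * P.apexC * coordW z') = (k + k') * P.apexC * coordW z' := by
    field_simp
  have e2 : k * k' * (P.apexW * (P.coordV z' + k'⁻¹ * k⁻¹ * P.coordU z')) =
      P.apexW * (P.coordU z' + k * k' * P.coordV z') := by
    field_simp
    ring
  rwa [e1, e2] at h2

variable {p r p' r' : ℝ} (h : p ^ 2 + r ^ 2 = 1) (h' : p' ^ 2 + r' ^ 2 = 1)

/-- A direction at the apex that points into the half-pants lies below the zipper. -/
theorem slope_le_of_ray_mem {t : ℝ} (ht : 0 < t) (hmem : P.ray h t ∈ P.coverSet) :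
    r * (1 + P.factor) ≤ -(P.apexW * |p| * (P.factor - 1)) := by
  rw [mem_coverSet_iff] at hmem
  have hs := Real.sinh_pos_iff.2 ht
  have hq := P.factor_pos
  have h0 := hmem.2 0
  have h1 := hmem.2 (-1)
  simp only [coordU_ray, coordV_ray, coordW_ray, zpow_zero, zero_add, zpow_one, neg_add_cancel,
    zpow_neg, mul_one, one_mul] at h0 h1
  have h1' : (1 + P.factor) * P.apexC *
      (Real.cosh t * P.apexW + Real.sinh t * (r * P.apexC)) ≤
      P.apexW * (P.factor * (Real.cosh t * P.apexC + Real.sinh t * (p + r * P.apexW)) +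
      (Real.cosh t * P.apexC + Real.sinh t * (-p + r * P.apexW))) := by
    have h2 := mul_le_mul_of_nonneg_left h1 hq.le
    have e : P.factor * P.factor⁻¹ = 1 := mul_inv_cancel₀ hq.ne'
    linear_combination h2 - P.apexC *
      (Real.cosh t * P.apexW + Real.sinh t * (r * P.apexC)) * e + P.apexW *
      (Real.cosh t * P.apexC + Real.sinh t * (-p + r * P.apexW)) * e
  have hcw := P.apexC_sq
  rcases abs_cases p with ⟨e, -⟩ | ⟨e, -⟩ <;> rw [e]
  · refine le_of_mul_le_mul_left ?_ hs
    linear_combination h0 - Real.sinh t * r * (1 + P.factor) * hcw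
  · refine le_of_mul_le_mul_left ?_ hs
    linear_combination h1' - Real.sinh t * r * (1 + P.factor) * hcw

/-- The two ends of the zipper at the apex are symmetric, and the angle with the nearer one depends
only on the direction `(|p|, r)`. -/
theorem exists_zipperAngle_eq : ∃ b s : ℝ, 0 < b ∧ b ^ 2 + s ^ 2 = 1 ∧
    s * (1 + P.factor) = -(P.apexW * b * (P.factor - 1)) ∧
    ∀ (p r : ℝ) (h : p ^ 2 + r ^ 2 = 1) (t : ℝ), 0 < t →
      P.zipperAngle (P.ray h t) = Real.arccos (b * |p| + s * r) := by
  have hq := P.one_lt_factor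
  have hc := P.apexC_pos
  have hne : P.deck 1 P.apex ≠ P.apex := by
    intro e
    have := congrArg P.coordU e
    rw [coordU_deck, zpow_one, coordU_apex] at this
    nlinarith
  obtain ⟨b, s, hbs, hB⟩ := P.exists_ray_eq hne
  have hd : 0 < dist P.apex (P.deck 1 P.apex) := dist_pos.2 hne.symm
  set d := dist P.apex (P.deck 1 P.apex)
  have hsd := Real.sinh_pos_iff.2 hd
  have hU := P.coordU_ray hbs d
  have hV := P.coordV_ray hbs d
  have hW := P.coordW_ray hbs d
  rw [← hB, coordU_deck, coordU_apex, zpow_one] at hU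
  rw [← hB, coordV_deck, coordV_apex, zpow_one] at hV
  rw [← hB, coordW_deck, coordW_apex] at hW
  have hV' : P.apexC = P.factor *
      (Real.cosh d * P.apexC + Real.sinh d * (-b + s * P.apexW)) := by
    rw [← hV]; field_simp
  have hbs' : (-b) ^ 2 + s ^ 2 = 1 := by rw [neg_sq]; exact hbs
  have hB' : P.deck (-1) P.apex = P.ray hbs' d := by
    refine P.ext_coord ?_ ?_
    · rw [coordV_deck, ← (P.ray_neg_slope hbs d hbs').1, ← hB, coordU_deck, zpow_one, zpow_neg,
        coordU_apex, coordV_apex, zpow_one]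
      field_simp
    · rw [coordW_deck, coordW_ray, coordW_apex]; exact hW
  have hb : 0 < b := by
    have e : Real.sinh d * (2 * b) = P.factor * P.apexC - P.apexC / P.factor := by
      rw [hU, hV]; ring
    have e1 : P.apexC / P.factor < P.apexC := div_lt_self hc hq
    have : 0 < Real.sinh d * (2 * b) := by rw [e]; nlinarith
    have := pos_of_mul_pos_right this hsd.le
    linarith
  refine ⟨b, s, hb, hbs, ?_, fun p r h t ht => ?_⟩
  · have hcw := P.apexC_sq
    refine mul_left_cancel₀ hsd.ne' ?_
    linear_combination (1 + P.factor) * P.apexC * (- hW) + P.apexW * hU + P.apexW * hV'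
      - Real.sinh d * s * (1 + P.factor) * hcw
  · have hst := Real.sinh_pos_iff.2 ht
    have key : ∀ (b' s' : ℝ) (hb' : b' ^ 2 + s' ^ 2 = 1),
        hypAngle P.apex (P.ray hb' d) (P.ray h t) = Real.arccos (b' * p + s' * r) := by
      intro b' s' hb'
      have e1 : ∀ (a e : ℝ) (hae : a ^ 2 + e ^ 2 = 1) (x : ℝ), 0 < x →
          dist P.apex (P.ray hae x) = x := by
        intro a e hae x hx
        rw [← P.ray_zero hae, dist_ray, zero_sub, abs_neg, abs_of_pos hx]
      rw [hypAngle, e1 _ _ _ _ hd, e1 _ _ _ _ ht, cosh_dist_ray_ray]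
      congr 1
      field_simp
      ring
    have ha : b * |p| + s * r = max (b * p + s * r) (-b * p + s * r) := by
      rw [max_add_add_right, neg_mul, ← abs_eq_max_neg, abs_mul, abs_of_pos hb]
    rw [zipperAngle, hB, hB', key _ _ hbs, key _ _ hbs', ha, Real.antitone_arccos.map_max]

/-- For unit vectors `(x, r)` below the line of slope `-m`, the inner product with `(b, -m b)` is a
strictly increasing function of `r`. -/
theorem zipper_cos_lt {b m x r x' r' : ℝ} (hb : 0 < b) (hm : 0 < m) (h : x ^ 2 + r ^ 2 = 1)
    (h' : x' ^ 2 + r' ^ 2 = 1) (hx : 0 ≤ x) (hx' : 0 ≤ x') (hr : r ≤ -(m * x)) (hlt : r' < r) :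
    b * x' + -(m * b) * r' < b * x + -(m * b) * r := by
  have hr0 : r ≤ 0 := hr.trans (neg_nonpos.2 (mul_nonneg hm.le hx))
  have hxx : x' < x := by
    refine lt_of_pow_lt_pow_left₀ 2 hx ?_
    nlinarith
  have hd : 0 < r - r' := sub_pos.2 hlt
  have e : (x - x') * (x + x') = (r - r') * (-(r + r')) := by linear_combination h - h'
  have e1 : m * (x + x') < -(r + r') := by
    have := mul_lt_mul_of_pos_left hxx hm
    linarith
  have e2 : m * (r - r') * (x + x') < (x - x') * (x + x') := by
    rw [e]
    linear_combination (r - r') * e1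
  have e3 : m * (r - r') < x - x' := lt_of_mul_lt_mul_right e2 (by linarith)
  linear_combination b * e3

/-- Among the directions that point into the half-pants, the angle with the zipper increases as the
component `r` pointing away from the cuff decreases. -/
theorem zipperAngle_ray_le_iff {t t' : ℝ} (ht : 0 < t) (ht' : 0 < t')
    (hm : P.ray h t ∈ P.coverSet) (hm' : P.ray h' t' ∈ P.coverSet) :
    P.zipperAngle (P.ray h t) ≤ P.zipperAngle (P.ray h' t') ↔ r' ≤ r := by
  obtain ⟨b, s, hb, hbs, hs, hz⟩ := P.exists_zipperAngle_eq
  rw [hz p r h t ht, hz p' r' h' t' ht']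
  have hr := P.slope_le_of_ray_mem h ht hm
  have hr' := P.slope_le_of_ray_mem h' ht' hm'
  have hq := P.one_lt_factor
  have hw := P.apexW_pos
  obtain ⟨m, hm, hmq⟩ : ∃ m : ℝ, 0 < m ∧ m * (1 + P.factor) = P.apexW * (P.factor - 1) :=
    ⟨P.apexW * (P.factor - 1) / (1 + P.factor),
      div_pos (mul_pos hw (by linarith)) (by linarith), by field_simp⟩
  have hq1 : 0 < 1 + P.factor := by linarith
  have es : s = -(m * b) := by
    refine mul_right_cancel₀ hq1.ne' ?_
    linear_combination hs + b * hmq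
  have er : r ≤ -(m * |p|) := by
    refine le_of_mul_le_mul_right ?_ hq1
    linear_combination hr + |p| * hmq
  have er' : r' ≤ -(m * |p'|) := by
    refine le_of_mul_le_mul_right ?_ hq1
    linear_combination hr' + |p'| * hmq
  rw [← sq_abs p] at h
  rw [← sq_abs p'] at h'
  have hp := abs_nonneg p
  have hp' := abs_nonneg p'
  generalize |p| = x at *
  generalize |p'| = x' at *
  have bound : ∀ x r : ℝ, x ^ 2 + r ^ 2 = 1 → b * x + s * r ∈ Set.Icc (-1) 1 := by
    intro x r h
    have : (b * x + s * r) ^ 2 ≤ 1 := by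
      have e : (b * x + s * r) ^ 2 + (b * r - s * x) ^ 2 = 1 := by
        linear_combination (x ^ 2 + r ^ 2) * hbs + h
      nlinarith [sq_nonneg (b * r - s * x)]
    exact abs_le.1 ((sq_le_one_iff_abs_le_one _).1 this)
  constructor
  · intro hle
    by_contra! hlt
    have := Real.strictAntiOn_arccos (bound x r h) (bound x' r' h')
      (by rw [es]; exact zipper_cos_lt hb hm h' h hp' hp er' hlt)
    linarith
  · intro hle
    rcases hle.eq_or_lt with rfl | hlt
    · have : x = x' := by
        have : x ^ 2 = x' ^ 2 := by linarith
        exact (pow_left_inj₀ hp hp' two_ne_zero).1 this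
      rw [this]
    · exact Real.antitone_arccos (by rw [es]; exact (zipper_cos_lt hb hm h h' hp hp' er hlt).le)

theorem spiral_direction : (1 / P.apexC) ^ 2 + (-(P.apexW / P.apexC)) ^ 2 = 1 := by
  have hc := P.apexC_pos.ne'
  field_simp
  linarith [P.apexC_sq]

theorem coordW_spiral (t : ℝ) :
    coordW (P.ray P.spiral_direction t) = P.apexW * Real.exp (-t) := by
  have hc := P.apexC_pos.ne'
  rw [coordW_ray, ← Real.cosh_sub_sinh]
  field_simp
  ring

theorem coordV_spiral (t : ℝ) :
    P.coordV (P.ray P.spiral_direction t) = P.apexC * Real.exp (-t) := by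
  have hc := P.apexC_pos.ne'
  rw [coordV_ray, ← Real.cosh_sub_sinh]
  field_simp
  linear_combination Real.sinh t * P.apexC_sq

theorem spiral_mem_coverSet {t : ℝ} (ht : 0 ≤ t) :
    P.ray P.spiral_direction t ∈ P.coverSet := by
  have hc := P.apexC_pos
  have hw := P.apexW_pos
  have hE := Real.exp_pos (-t)
  have hE1 : Real.exp (-t) ≤ 1 := Real.exp_le_one_iff.2 (by linarith)
  have hUV := P.coordU_mul_coordV (P.ray P.spiral_direction t)
  rw [mem_coverSet_iff]
  rw [coordV_spiral, coordW_spiral] at *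
  refine ⟨by positivity, fun n => ?_⟩
  have h0 := ((P.mem_coverSet_iff P.apex).1 P.apex_mem).2 n
  rw [coordU_apex, coordV_apex, coordW_apex] at h0
  generalize P.factor ^ n = k at *
  generalize P.factor ^ (n + 1) = k' at *
  generalize Real.exp (-t) = E at *
  generalize P.coordU (P.ray P.spiral_direction t) = U at *
  have h1 : P.apexC * E ≤ U := by
    refine le_of_mul_le_mul_right ?_ (mul_pos hc hE)
    rw [hUV]
    have : E ^ 2 ≤ 1 := by nlinarith
    linear_combination this + E ^ 2 * P.apexC_sq
  nlinarith [mul_le_mul_of_nonneg_left h0 hE.le]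

theorem proj_eq_proj_iff {z w : P.Cover} : P.proj z = P.proj w ↔ ∃ n : ℤ, (w : ℍ) = P.deck n z :=
  ⟨fun e => Quotient.exact e, fun e => Quotient.sound e⟩

/-- The geodesic from the apex to an end of the lifted cuff spirals towards the cuff. -/
theorem exists_isSpiralRay : ∃ γ : ℝ → P.Cover, P.IsSpiralRay γ ∧
    (γ 1 : ℍ) = P.ray P.spiral_direction 1 := by
  refine ⟨fun t => ⟨P.ray P.spiral_direction |t|, P.spiral_mem_coverSet (abs_nonneg t)⟩,
    ⟨?_, ?_, ?_, ?_⟩, by simp⟩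
  · apply Subtype.ext; simp [apexLift]
  · intro s t hs ht
    rw [Subtype.dist_eq]
    change dist (P.ray P.spiral_direction |s|) (P.ray P.spiral_direction |t|) = _
    rw [dist_ray, abs_of_nonneg hs, abs_of_nonneg ht]
  · intro s hs t ht hst
    obtain ⟨n, hn⟩ := P.proj_eq_proj_iff.1 hst
    have e := congrArg coordW hn
    rw [coordW_deck, coordW_spiral, coordW_spiral] at e
    have := mul_left_cancel₀ P.apexW_pos.ne' e
    rw [Real.exp_eq_exp, abs_of_nonneg (Set.mem_Ici.1 hs), abs_of_nonneg (Set.mem_Ici.1 ht)] at this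
    linarith
  · intro ε hε
    have hcosh : 1 < Real.cosh ε := Real.one_lt_cosh.2 hε.ne'
    have lim : Filter.Tendsto (fun t : ℝ => 1 + (P.apexW * Real.exp (-t)) ^ 2 / 2) Filter.atTop
        (nhds (1 + (P.apexW * 0) ^ 2 / 2)) :=
      (((Real.tendsto_exp_neg_atTop_nhds_zero.const_mul _).pow 2).div_const 2).const_add 1
    obtain ⟨t, ht, ht0⟩ := ((lim.eventually_lt_const (u := Real.cosh ε) (by simpa using hε.ne')).and
      (Filter.eventually_ge_atTop 0)).exists
    rw [← abs_of_nonneg ht0] at ht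
    set z := P.ray P.spiral_direction |t| with hz
    have hv := P.coordV_pos z
    refine ⟨t, ht0, P.ofCoord (P.coordV z) 0 hv, ?_, ?_⟩
    · change P.modulus * 0 / P.coordV z = 0
      simp
    · change dist z _ < ε
      rw [← abs_of_nonneg (dist_nonneg (x := z)), ← abs_of_pos hε, ← Real.cosh_lt_cosh]
      refine lt_of_eq_of_lt ?_ ht
      have e1 := P.coordU_mul_coordV (P.ofCoord (P.coordV z) 0 hv)
      have e2 := P.coordU_mul_coordV z
      rw [cosh_dist_eq]
      rw [coordV_ofCoord, coordW_ofCoord] at *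
      rw [← coordW_spiral, ← hz]
      linear_combination e1 / 2 + e2 / 2

theorem exists_isSpiralAngle : P.IsSpiralAngle (P.zipperAngle (P.ray P.spiral_direction 1)) := by
  obtain ⟨γ, hγ, h1⟩ := P.exists_isSpiralRay
  exact ⟨γ, hγ, by rw [h1]⟩

/-- A geodesic ray that stays in the cover forever does not point too steeply at the cuff. -/
theorem neg_apexW_le_of_forall_mem (hm : ∀ t, 0 ≤ t → P.ray h t ∈ P.coverSet) :
    -P.apexW ≤ r * P.apexC := by
  have lim : Filter.Tendsto (fun t : ℝ => (P.apexW + r * P.apexC) +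
      (P.apexW - r * P.apexC) * Real.exp (-t) ^ 2) Filter.atTop
        (nhds ((P.apexW + r * P.apexC) + (P.apexW - r * P.apexC) * 0 ^ 2)) :=
    ((Real.tendsto_exp_neg_atTop_nhds_zero.pow 2).const_mul _).const_add _
  have := ge_of_tendsto lim (Filter.eventually_atTop.2 ⟨0, fun t ht => ?_⟩ :
    ∀ᶠ t in Filter.atTop, 0 ≤ (P.apexW + r * P.apexC) +
      (P.apexW - r * P.apexC) * Real.exp (-t) ^ 2)
  · linarith
  · have h1 := hm t ht
    rw [mem_coverSet_iff] at h1
    have h2 := h1.1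
    rw [coordW_ray, Real.cosh_eq, Real.sinh_eq] at h2
    have hE := Real.exp_pos (-t)
    have e : Real.exp t * Real.exp (-t) = 1 := by rw [← Real.exp_add]; simp
    have h3 := mul_nonneg h2 hE.le
    linear_combination 2 * h3 + (P.apexW + r * P.apexC) * e

/-- The spiral-angle is realised by the direction with `r * apexC = -apexW`, so being within it
means `-apexW ≤ r * apexC`. -/
theorem neg_apexW_le_of_zipperAngle_le {σ t : ℝ} (hσ : P.IsSpiralAngle σ) (ht : 0 < t)
    (hm : P.ray h t ∈ P.coverSet) (hle : P.zipperAngle (P.ray h t) ≤ σ) :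
    -P.apexW ≤ r * P.apexC := by
  obtain ⟨γ, hγ, rfl⟩ := hσ
  have key : ∀ R : ℝ, 0 < R → ∃ (p' r' : ℝ) (h' : p' ^ 2 + r' ^ 2 = 1),
      Set.EqOn (fun t => (γ t : ℍ)) (P.ray h') (Set.Icc 0 R) := fun R hR =>
    P.exists_eqOn_ray hR (by rw [hγ.start]; rfl) fun s hs t ht => hγ.geodesic s t hs.1 ht.1
  obtain ⟨p', r', h', e'⟩ := key 1 one_pos
  have hm1 : P.ray h' 1 ∈ P.coverSet := by
    rw [← e' ⟨zero_le_one, le_rfl⟩]; exact (γ 1).2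
  rw [show (γ 1 : ℍ) = _ from e' ⟨zero_le_one, le_rfl⟩,
    P.zipperAngle_ray_le_iff h h' ht one_pos hm hm1] at hle
  have h2 : -P.apexW ≤ r' * P.apexC := by
    refine P.neg_apexW_le_of_forall_mem h' fun t ht => ?_
    obtain ⟨p2, r2, h2, e2⟩ := key (t + 1) (by linarith)
    have hs : Real.sinh 1 ≠ 0 := (Real.sinh_pos_iff.2 one_pos).ne'
    have e3 : P.ray h' 1 = P.ray h2 1 :=
      (e' ⟨zero_le_one, le_rfl⟩).symm.trans (e2 ⟨zero_le_one, by linarith⟩)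
    have e4 : r' = r2 := by
      have := congrArg coordW e3
      rw [coordW_ray, coordW_ray] at this
      exact mul_right_cancel₀ P.apexC_pos.ne' (mul_left_cancel₀ hs (add_left_cancel this))
    subst e4
    have e5 : p' = p2 := by
      have := congrArg P.coordV e3
      rw [coordV_ray, coordV_ray] at this
      have := mul_left_cancel₀ hs (add_left_cancel this)
      linarith
    subst e5
    rw [← e2 ⟨ht, by linarith⟩]
    exact (γ t).2
  nlinarith [P.apexC_pos]

end HalfPants

namespace HalfPants
variable (P : HalfPants) {p r : ℝ} (h : p ^ 2 + r ^ 2 = 1)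

/-! ### Rays that self-intersect and rays that reach the cuff -/

/-- Used to find the time at which a ray reaches the cuff, or its point closest to the cuff. -/
theorem exists_exp_balance {a b : ℝ} (ha : 0 < a) (hab : a < b) :
    ∃ t : ℝ, 0 < t ∧ Real.exp t * a = Real.exp (-t) * b := by
  have hb := ha.trans hab
  refine ⟨(Real.log b - Real.log a) / 2, by linarith [Real.log_lt_log ha hab], ?_⟩
  nth_rw 2 [← Real.exp_log ha]
  nth_rw 3 [← Real.exp_log hb]
  rw [← Real.exp_add, ← Real.exp_add]
  congr 1
  ring

theorem sinh_add_sinh_lt {a b : ℝ} (ha : 0 < a) (hb : 0 < b) :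
    Real.sinh a + Real.sinh b < Real.sinh (a + b) := by
  rw [Real.sinh_add]
  have h1 := Real.one_lt_cosh.2 ha.ne'
  have h2 := Real.one_lt_cosh.2 hb.ne'
  have h3 := Real.sinh_pos_iff.2 ha
  have h4 := Real.sinh_pos_iff.2 hb
  nlinarith

theorem coord_ray_between {a b : ℝ} (ha : 0 ≤ a) (hb : 0 ≤ b) :
    Real.sinh (a + b) * P.coordU (P.ray h a) =
      Real.sinh b * P.apexC + Real.sinh a * P.coordU (P.ray h (a + b)) ∧
    Real.sinh (a + b) * P.coordV (P.ray h a) =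
      Real.sinh b * P.apexC + Real.sinh a * P.coordV (P.ray h (a + b)) ∧
    Real.sinh (a + b) * coordW (P.ray h a) =
      Real.sinh b * P.apexW + Real.sinh a * coordW (P.ray h (a + b)) := by
  have := P.coord_between (x := P.ray h 0) (y := P.ray h a) (z := P.ray h (a + b))
    (a := a) (b := b) (by rw [dist_ray, zero_sub, abs_neg, abs_of_nonneg ha])
    (by rw [dist_ray, sub_add_cancel_left, abs_neg, abs_of_nonneg hb])
    (by rw [dist_ray, zero_sub, abs_neg, abs_of_nonneg (add_nonneg ha hb)])
  rwa [ray_zero, coordU_apex, coordV_apex, coordW_apex] at this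

/-- A ray that points steeply enough at the cuff reaches it; up to then it stays in the cover, and
its distance to the cuff decreases strictly. -/
theorem exists_ray_hits_cuff (hr : r * P.apexC < -P.apexW) : ∃ T : ℝ, 0 < T ∧
    coordW (P.ray h T) = 0 ∧ P.ray h T ∈ P.coverSet ∧
    StrictAntiOn (fun t => coordW (P.ray h t)) (Set.Icc 0 T) := by
  have hw := P.apexW_pos
  obtain ⟨T, hT, hexp⟩ := exists_exp_balance (a := -(P.apexW + r * P.apexC))
    (b := P.apexW - r * P.apexC) (by linarith) (by linarith)
  have hW : coordW (P.ray h T) = 0 := by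
    rw [coordW_ray, Real.cosh_eq, Real.sinh_eq]
    linear_combination -hexp / 2
  refine ⟨T, hT, hW, ?_, fun s hs t ht hst => ?_⟩
  · rw [mem_coverSet_iff, hW]
    refine ⟨le_rfl, fun n => ?_⟩
    have h1 := zpow_pos P.factor_pos n
    have h2 := zpow_pos P.factor_pos (n + 1)
    have h3 := P.coordU_pos (P.ray h T)
    have h4 := P.coordV_pos (P.ray h T)
    rw [mul_zero]
    positivity
  · have e1 := (P.coord_ray_between h hs.1 (sub_nonneg.2 hs.2)).2.2
    have e2 := (P.coord_ray_between h ht.1 (sub_nonneg.2 ht.2)).2.2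
    rw [add_sub_cancel, hW, mul_zero, add_zero] at e1 e2
    have h1 : Real.sinh (T - t) < Real.sinh (T - s) := Real.sinh_lt_sinh.2 (by linarith)
    refine lt_of_mul_lt_mul_left ?_ (Real.sinh_pos_iff.2 hT).le
    change _ * coordW (P.ray h t) < _ * coordW (P.ray h s)
    rw [e1, e2]
    exact mul_lt_mul_of_pos_right h1 hw

set_option maxHeartbeats 1000000 in
/-- A ray launched on the side `0 < p` strictly between the spiral ray and the zipper (or along the
zipper) is a chord of the equidistant curve through the apex, from the apex to a point `A_κ` with
`factor ≤ κ`. Symmetric points of the chord are related by dilations whose factors increase from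
`1` to `κ`, so at some pair of them the factor is that of the generating deck transformation. The
later point is on the chord from the apex to `A_κ` and also on its translate; each side of the
lifted zipper has one of the two chords on its inner side, so the point lies in the cover. -/
theorem exists_self_intersection_of_pos (hp : 0 < p) (hr : -P.apexW < r * P.apexC) {t₀ : ℝ}
    (ht₀ : 0 < t₀) (hm : P.ray h t₀ ∈ P.coverSet) :
    ∃ s t : ℝ, 0 ≤ t ∧ t < s ∧ P.ray h s ∈ P.coverSet ∧
      (∀ τ ∈ Set.Ioo 0 s, coordW (P.ray h τ) < P.apexW) ∧ P.ray h s = P.deck 1 (P.ray h t) := by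
  have hq := P.one_lt_factor
  have hc := P.apexC_pos
  have hw := P.apexW_pos
  have hslope := P.slope_le_of_ray_mem h ht₀ hm
  rw [abs_of_pos hp] at hslope
  have hr0 : r * P.apexC < 0 := by
    have : 0 < P.apexW * p * (P.factor - 1) := by
      have : 0 < P.factor - 1 := by linarith
      positivity
    have : r < 0 := by nlinarith
    nlinarith
  obtain ⟨m, hm0, hexp⟩ := exists_exp_balance (a := P.apexW + r * P.apexC)
    (b := P.apexW - r * P.apexC) (by linarith) (by linarith)
  have hmin : Real.sinh m * P.apexW + Real.cosh m * (r * P.apexC) = 0 := by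
    rw [Real.cosh_eq, Real.sinh_eq]
    linear_combination hexp / 2
  -- the distance to the cuff is symmetric about the time `m`
  have hsymm : ∀ x, coordW (P.ray h (m + x)) = coordW (P.ray h (m - x)) := by
    intro x
    rw [coordW_ray, coordW_ray, Real.cosh_add, Real.cosh_sub, Real.sinh_add, Real.sinh_sub]
    linear_combination 2 * Real.sinh x * hmin
  have hWend : coordW (P.ray h (m + m)) = P.apexW := by
    rw [hsymm, sub_self, ray_zero, coordW_apex]
  have hsm : 0 < Real.sinh (m + m) := Real.sinh_pos_iff.2 (by linarith)
  obtain ⟨κ, hκ⟩ : ∃ κ, P.coordU (P.ray h (m + m)) = P.apexC * κ :=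
    ⟨P.coordU (P.ray h (m + m)) / P.apexC, by field_simp⟩
  have hκ0 : 0 < κ := by
    have := P.coordU_pos (P.ray h (m + m))
    rw [hκ] at this
    exact pos_of_mul_pos_right this hc.le
  have hVend : P.coordV (P.ray h (m + m)) = P.apexC / κ := by
    have := P.coordU_mul_coordV (P.ray h (m + m))
    rw [hWend, ← P.apexC_sq, hκ] at this
    rw [eq_div_iff hκ0.ne']
    refine mul_left_cancel₀ hc.ne' ?_
    linear_combination this
  have hκ1 : 1 < κ := by
    have e1 := P.coordU_ray h (m + m)
    have e2 := P.coordV_ray h (m + m)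
    have h1 : P.coordV (P.ray h (m + m)) < P.coordU (P.ray h (m + m)) := by
      rw [e1, e2]; nlinarith
    rw [hκ, hVend, div_lt_iff₀ hκ0] at h1
    by_contra! hle
    nlinarith [mul_nonneg hc.le (mul_nonneg (sub_nonneg.2 hle) (add_pos hκ0 one_pos).le)]
  -- the chord starts on the inner side of the zipper
  have hκq : P.factor ≤ κ := by
    have e1 := P.coordU_ray h (m + m)
    have e2 := P.coordV_ray h (m + m)
    have e3 := P.coordW_ray h (m + m)
    have h1 : 0 ≤ P.apexW * (P.coordU (P.ray h (m + m)) +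
        P.factor * P.coordV (P.ray h (m + m))) -
        (1 + P.factor) * P.apexC * coordW (P.ray h (m + m)) := by
      rw [e1, e2, e3]
      have := mul_nonneg hsm.le (sub_nonneg.2 hslope)
      linear_combination this + Real.sinh (m + m) * r * (1 + P.factor) * P.apexC_sq
    rw [hκ, hVend, hWend] at h1
    have h2 : P.apexW * (P.apexC * κ + P.factor * (P.apexC / κ)) -
        (1 + P.factor) * P.apexC * P.apexW =
        P.apexW * P.apexC * (κ - 1) / κ * (κ - P.factor) := by
      field_simp
      ring
    rw [h2] at h1
    have h3 : 0 < P.apexW * P.apexC * (κ - 1) / κ := by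
      have : 0 < κ - 1 := by linarith
      positivity
    exact sub_nonneg.1 (nonneg_of_mul_nonneg_right h1 h3)
  -- intermediate value theorem for the dilation factor between symmetric points
  obtain ⟨x, hx, hfx⟩ : ∃ x ∈ Set.Icc 0 m,
      P.coordU (P.ray h (m + x)) = P.factor * P.coordU (P.ray h (m - x)) := by
    have hcont : ContinuousOn (fun x => P.coordU (P.ray h (m + x)) -
        P.factor * P.coordU (P.ray h (m - x))) (Set.Icc 0 m) := by
      simp only [coordU_ray]
      exact Continuous.continuousOn (by
        have h1 := Real.continuous_cosh
        have h2 := Real.continuous_sinh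
        fun_prop)
    have hz : (0 : ℝ) ∈ Set.Icc (P.coordU (P.ray h (m + 0)) -
        P.factor * P.coordU (P.ray h (m - 0))) (P.coordU (P.ray h (m + m)) -
        P.factor * P.coordU (P.ray h (m - m))) := by
      constructor
      · rw [add_zero, sub_zero]
        nlinarith [P.coordU_pos (P.ray h m)]
      · rw [sub_self, ray_zero, hκ, coordU_apex]
        nlinarith
    obtain ⟨x, hx, hfx⟩ := intermediate_value_Icc hm0.le hcont hz
    exact ⟨x, hx, sub_eq_zero.1 hfx⟩
  have hx0 : 0 < x := by
    rcases hx.1.eq_or_lt with rfl | h0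
    · rw [add_zero, sub_zero] at hfx
      nlinarith [P.coordU_pos (P.ray h m)]
    · exact h0
  have hVx : P.coordV (P.ray h (m + x)) = P.coordV (P.ray h (m - x)) / P.factor := by
    have e1 := P.coordU_mul_coordV (P.ray h (m + x))
    have e2 := P.coordU_mul_coordV (P.ray h (m - x))
    rw [hsymm, ← e2, hfx] at e1
    have := P.coordU_pos (P.ray h (m - x))
    rw [eq_div_iff (by linarith)]
    refine mul_left_cancel₀ this.ne' ?_
    linear_combination e1
  obtain ⟨e1, e2, e3⟩ := P.coord_ray_between h (a := m + x) (b := m - x) (by linarith)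
    (by linarith [hx.2])
  obtain ⟨f1, f2, f3⟩ := P.coord_ray_between h (a := m - x) (b := m + x) (by linarith [hx.2])
    (by linarith)
  rw [show m + x + (m - x) = m + m by ring] at e1 e2 e3
  rw [show m - x + (m + x) = m + m by ring] at f1 f2 f3
  rw [hκ] at e1 f1
  rw [hVend] at e2 f2
  rw [hWend] at e3 f3
  have hs1 : 0 < Real.sinh (m + x) := Real.sinh_pos_iff.2 (by linarith)
  have hs2 : 0 ≤ Real.sinh (m - x) := Real.sinh_nonneg_iff.2 (by linarith [hx.2])
  refine ⟨m + x, m - x, by linarith [hx.2], by linarith, ?_, fun τ hτ => ?_, ?_⟩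
  · rw [mem_coverSet_iff]
    refine ⟨nonneg_of_mul_nonneg_right (by rw [e3]; positivity) hsm, fun n => ?_⟩
    have hk := zpow_pos P.factor_pos n
    have hk' : P.factor ^ (n + 1) = P.factor ^ n * P.factor := zpow_add_one₀ P.factor_pos.ne' n
    have g1 := ((P.mem_coverSet_iff _).1 P.apex_mem).2 n
    have g2 := ((P.mem_coverSet_iff _).1 (P.coverSet_deck P.apex_mem 1)).2 n
    rw [coordU_deck, coordV_deck, coordW_deck, zpow_one] at g2
    simp only [coordU_apex, coordV_apex, coordW_apex] at g1 g2
    rw [hk'] at g1 g2 ⊢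
    generalize P.factor ^ n = k at *
    refine le_of_mul_le_mul_left ?_ hsm
    by_cases hout : 0 ≤ (κ - k) * (κ - k * P.factor)
    · have g3 : (k + k * P.factor) * P.apexC * P.apexW ≤
          P.apexW * (P.apexC * κ + k * (k * P.factor) * (P.apexC / κ)) := by
        have e : P.apexW * (P.apexC * κ + k * (k * P.factor) * (P.apexC / κ)) -
            (k + k * P.factor) * P.apexC * P.apexW =
            P.apexW * P.apexC / κ * ((κ - k) * (κ - k * P.factor)) := by
          field_simp
          ring
        rw [← sub_nonneg, e]
        positivity
      have i1 := mul_le_mul_of_nonneg_left g1 hs2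
      have i2 := mul_le_mul_of_nonneg_left g3 hs1.le
      linear_combination i1 + i2 - P.apexW * e1 - P.apexW * k * (k * P.factor) * e2
        + (k + k * P.factor) * P.apexC * e3
    · have g3 : (k + k * P.factor) * P.apexC * P.apexW ≤ P.apexW *
          (P.factor * (P.apexC * κ) + k * (k * P.factor) * (P.apexC / κ / P.factor)) := by
        have e : P.apexW *
            (P.factor * (P.apexC * κ) + k * (k * P.factor) * (P.apexC / κ / P.factor)) -
            (k + k * P.factor) * P.apexC * P.apexW =
            P.apexW * P.apexC / κ * ((P.factor * κ - k) * (κ - k)) := by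
          field_simp
          ring
        have hk1 : k ≤ κ := by
          by_contra! hlt
          exact hout (mul_nonneg_of_nonpos_of_nonpos (by linarith) (by nlinarith))
        have hk2 : 0 ≤ (P.factor * κ - k) * (κ - k) :=
          mul_nonneg (by nlinarith) (by linarith)
        rw [← sub_nonneg, e]
        positivity
      rw [hfx, hVx, hsymm]
      have i1 := mul_le_mul_of_nonneg_left g2 hs1.le
      have i2 := mul_le_mul_of_nonneg_left g3 hs2
      have f2' : Real.sinh (m + m) * (P.coordV (P.ray h (m - x)) / P.factor) =
          Real.sinh (m + x) * (P.apexC / P.factor) +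
          Real.sinh (m - x) * (P.apexC / κ / P.factor) := by
        rw [← mul_div_assoc, f2]; ring
      linear_combination i1 + i2 - P.apexW * P.factor * f1 - P.apexW * k * (k * P.factor) * f2'
        + (k + k * P.factor) * P.apexC * f3
  · have e := (P.coord_ray_between h (a := τ) (b := m + m - τ) hτ.1.le
      (by linarith [hτ.2, hx.2])).2.2
    rw [add_sub_cancel, hWend] at e
    have h1 := sinh_add_sinh_lt (a := τ) (b := m + m - τ) hτ.1 (by linarith [hτ.2, hx.2])
    rw [add_sub_cancel] at h1
    refine lt_of_mul_lt_mul_left ?_ hsm.le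
    rw [e]
    nlinarith
  · refine P.ext_coord ?_ ?_
    · rw [coordV_deck, zpow_one, hVx]
    · rw [coordW_deck, hsymm]

/-- A ray launched strictly between a spiral ray and the nearer end of the zipper (or along the
zipper) meets one of its translates before it leaves the cover. -/
theorem exists_self_intersection (hr : -P.apexW < r * P.apexC) {t₀ : ℝ} (ht₀ : 0 < t₀)
    (hm : P.ray h t₀ ∈ P.coverSet) :
    ∃ s t : ℝ, 0 ≤ t ∧ t < s ∧ P.ray h s ∈ P.coverSet ∧
      (∀ τ ∈ Set.Ioo 0 s, coordW (P.ray h τ) < P.apexW) ∧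
      ∃ n : ℤ, P.ray h s = P.deck n (P.ray h t) := by
  have hW : ∀ (hn : (-p) ^ 2 + r ^ 2 = 1) (t : ℝ), coordW (P.ray h t) = coordW (P.ray hn t) :=
    fun hn t => by rw [coordW_ray, coordW_ray]
  rcases lt_trichotomy p 0 with hp | hp | hp
  · -- the reflection in the perpendicular from the apex to the cuff exchanges `p` and `-p`
    have hn : (-p) ^ 2 + r ^ 2 = 1 := by rw [neg_sq]; exact h
    have hswap := fun t => P.ray_neg_slope h t hn
    obtain ⟨s, t, ht, hts, hs, hlt, he⟩ := P.exists_self_intersection_of_pos hn (neg_pos.2 hp) hr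
      ht₀ (P.coverSet_congr_swap (hswap t₀).1 (hswap t₀).2 (hW hn t₀) hm)
    refine ⟨s, t, ht, hts, P.coverSet_congr_swap (hswap s).2.symm (hswap s).1.symm
      (hW hn s).symm hs, fun τ hτ => by rw [hW hn]; exact hlt τ hτ, -1, P.ext_coord ?_ ?_⟩
    · rw [(hswap s).2, he, coordU_deck, coordV_deck, (hswap t).2, zpow_neg, zpow_one,
        div_inv_eq_mul, mul_comm]
    · rw [coordW_deck, hW hn, hW hn, he, coordW_deck]
  · exfalso
    have hslope := P.slope_le_of_ray_mem h ht₀ hm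
    subst hp
    have hq := P.one_lt_factor
    have hr0 : r ≤ 0 := by
      simp only [abs_zero, mul_zero, zero_mul, neg_zero] at hslope
      nlinarith
    have hr1 : r = -1 := by nlinarith
    rw [hr1] at hr
    linarith [P.apexW_lt_apexC]
  · obtain ⟨s, t, ht, hts, hs, hlt, he⟩ := P.exists_self_intersection_of_pos h hp hr ht₀ hm
    exact ⟨s, t, ht, hts, hs, hlt, 1, he⟩

end HalfPants

/-! ### Geodesics through regular points of a surface -/

theorem addCircle_two_pi_norm_le (φ : AddCircle (2 * Real.pi)) : ‖φ‖ ≤ Real.pi := by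
  have := AddCircle.norm_le_half_period (2 * Real.pi) (x := φ) (by positivity)
  rwa [abs_of_pos (by positivity), mul_div_cancel_left₀ _ two_ne_zero] at this

theorem addCircle_two_pi_norm_pi : ‖((Real.pi : ℝ) : AddCircle (2 * Real.pi))‖ = Real.pi := by
  have := AddCircle.norm_half_period_eq (2 * Real.pi)
  rwa [abs_of_pos (by positivity), mul_div_cancel_left₀ _ two_ne_zero] at this

theorem addCircle_two_pi_eq_pi {φ : AddCircle (2 * Real.pi)} (h : ‖φ‖ = Real.pi) :
    φ = (Real.pi : ℝ) := by
  induction φ using QuotientAddGroup.induction_on with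
  | H x =>
    have h1 : ‖(x : AddCircle (2 * Real.pi))‖ = Real.pi := h
    rw [AddCircle.norm_eq] at h1
    set n := round ((2 * Real.pi)⁻¹ * x)
    change (x : AddCircle (2 * Real.pi)) = _
    rw [← sub_eq_zero, ← AddCircle.coe_sub, AddCircle.coe_eq_zero_iff]
    rcases eq_or_eq_neg_of_abs_eq h1 with h2 | h2
    · exact ⟨n, by rw [zsmul_eq_mul]; linarith⟩
    · exact ⟨n - 1, by rw [zsmul_eq_mul]; push_cast; linarith⟩

theorem HasConeAngle.exists_polar {S : Type*} [MetricSpace S] {p : S}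
    (hp : HasConeAngle p (2 * Real.pi)) :
    ∃ ε : ℝ, 0 < ε ∧ ∃ X : ℝ → AddCircle (2 * Real.pi) → S,
      (∀ φ, X 0 φ = p) ∧
      (∀ q, dist q p < ε → ∃ φ, X (dist q p) φ = q) ∧
      (∀ r ∈ Set.Ico 0 ε, ∀ r₁ ∈ Set.Ico 0 ε, ∀ φ φ₁ : AddCircle (2 * Real.pi),
        Real.cosh (dist (X r φ) (X r₁ φ₁)) =
          Real.cosh r * Real.cosh r₁ - Real.sinh r * Real.sinh r₁ * Real.cos ‖φ - φ₁‖) := by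
  obtain ⟨-, ε, hε, X, h0, hsurj, hd⟩ := hp
  refine ⟨ε, hε, X, h0, fun q hq => ?_, fun r hr r₁ hr₁ φ φ₁ => ?_⟩
  · obtain ⟨r, hr, φ, rfl⟩ := hsurj q hq
    refine ⟨φ, ?_⟩
    have h1 := hd r hr 0 ⟨le_rfl, hε⟩ φ φ
    rw [h0, Real.cosh_zero, Real.sinh_zero, mul_one, mul_zero, zero_mul, sub_zero] at h1
    rw [HalfPants.eq_of_cosh_eq_cosh dist_nonneg hr.1 h1]
  · rw [hd r hr r₁ hr₁, min_eq_left (addCircle_two_pi_norm_le _)]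

/-- Opposite directions: if the distances add up in polar coordinates, the angles differ by `π`. -/
theorem addCircle_eq_add_pi {a b : ℝ} (ha : 0 < a) (hb : 0 < b) {φ φ₁ : AddCircle (2 * Real.pi)}
    (h : Real.cosh (a + b) =
      Real.cosh a * Real.cosh b - Real.sinh a * Real.sinh b * Real.cos ‖φ - φ₁‖) :
    φ = φ₁ + (Real.pi : ℝ) := by
  rw [Real.cosh_add] at h
  have hs := mul_pos (Real.sinh_pos_iff.2 ha) (Real.sinh_pos_iff.2 hb)
  have hc : Real.cos ‖φ - φ₁‖ = Real.cos Real.pi := by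
    rw [Real.cos_pi]
    refine mul_left_cancel₀ hs.ne' ?_
    linarith
  have := Real.injOn_cos ⟨norm_nonneg _, addCircle_two_pi_norm_le _⟩
    ⟨Real.pi_pos.le, le_rfl⟩ hc
  exact sub_eq_iff_eq_add'.1 (addCircle_two_pi_eq_pi this)

/-- A geodesic has at most one continuation through a point of cone angle `2 * π`. -/
theorem HasConeAngle.exists_unique_continuation {S : Type*} [MetricSpace S] {p : S}
    (hp : HasConeAngle p (2 * Real.pi)) :
    ∃ ε : ℝ, 0 < ε ∧ ∀ q x y : S, 0 < dist q p → dist q p < ε → dist x p < ε →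
      dist x p = dist y p → dist q x = dist q p + dist x p → dist q y = dist q p + dist y p →
      x = y := by
  obtain ⟨ε, hε, X, h0, hsurj, hd⟩ := hp.exists_polar
  refine ⟨ε, hε, fun q x y hq0 hq hx hxy h1 h2 => ?_⟩
  rcases (dist_nonneg (x := x) (y := p)).eq_or_lt with hx0 | hx0
  · rw [dist_eq_zero.1 hx0.symm, dist_eq_zero.1 (hxy.symm.trans hx0.symm)]
  have hqm : dist q p ∈ Set.Ico 0 ε := ⟨dist_nonneg, hq⟩
  have hxm : dist x p ∈ Set.Ico 0 ε := ⟨dist_nonneg, hx⟩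
  obtain ⟨φ, hφ⟩ := hsurj q hq
  obtain ⟨φx, hφx⟩ := hsurj x hx
  obtain ⟨φy, hφy⟩ := hsurj y (hxy ▸ hx)
  rw [← hxy] at hφy h2
  have d1 := hd _ hqm _ hxm φ φx
  have d2 := hd _ hqm _ hxm φ φy
  rw [hφ, hφx, h1] at d1
  rw [hφ, hφy, h2] at d2
  have e := (addCircle_eq_add_pi hq0 hx0 d1).symm.trans (addCircle_eq_add_pi hq0 hx0 d2)
  rw [← hφx, ← hφy, add_right_cancel e]

/-- A geodesic can be continued through a point of cone angle `2 * π`. -/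
theorem HasConeAngle.exists_continuation {S : Type*} [MetricSpace S] {p : S}
    (hp : HasConeAngle p (2 * Real.pi)) :
    ∃ ε : ℝ, 0 < ε ∧ ∀ q : S, 0 < dist q p → dist q p < ε → ∃ g : ℝ → S, g 0 = p ∧
      (∀ s ∈ Set.Ico 0 ε, ∀ t ∈ Set.Ico 0 ε, dist (g s) (g t) = |s - t|) ∧
      ∀ x : S, dist q x + dist x p = dist q p → ∀ s ∈ Set.Ico 0 ε,
        dist x (g s) = dist x p + s := by
  obtain ⟨ε, hε, X, h0, hsurj, hd⟩ := hp.exists_polar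
  refine ⟨ε, hε, fun q hq0 hq => ?_⟩
  obtain ⟨φ, hφ⟩ := hsurj q hq
  have hqm : dist q p ∈ Set.Ico 0 ε := ⟨dist_nonneg, hq⟩
  have hg : ∀ s ∈ Set.Ico 0 ε, ∀ t ∈ Set.Ico 0 ε, ∀ ψ,
      dist (X s ψ) (X t ψ) = |s - t| := by
    intro s hs t ht ψ
    refine HalfPants.eq_of_cosh_eq_cosh dist_nonneg (abs_nonneg _) ?_
    rw [hd s hs t ht, sub_self, norm_zero, Real.cos_zero, mul_one, Real.cosh_abs, Real.cosh_sub]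
  refine ⟨fun s => X s (φ + (Real.pi : ℝ)), h0 _, fun s hs t ht => hg s hs t ht _,
    fun x hx s hs => ?_⟩
  have hxp : dist x p ≤ dist q p := by linarith [dist_nonneg (x := q) (y := x)]
  have hxm : dist x p ∈ Set.Ico 0 ε := ⟨dist_nonneg, hxp.trans_lt hq⟩
  obtain ⟨ψ, hψ⟩ := hsurj x hxm.2
  -- `x` has the same polar angle as `q`
  have hxφ : X (dist x p) φ = x := by
    rcases (dist_nonneg (x := x) (y := p)).eq_or_lt with hx0 | hx0
    · rw [← hx0, h0, dist_eq_zero.1 hx0.symm]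
    · have d1 := hd _ hqm _ hxm φ ψ
      rw [hφ, hψ, show dist q x = dist q p - dist x p by linarith, Real.cosh_sub] at d1
      have hs := mul_pos (Real.sinh_pos_iff.2 hq0) (Real.sinh_pos_iff.2 hx0)
      have hc : Real.cos ‖φ - ψ‖ = Real.cos 0 := by
        rw [Real.cos_zero]
        refine mul_left_cancel₀ hs.ne' ?_
        linarith
      have := Real.injOn_cos ⟨norm_nonneg _, addCircle_two_pi_norm_le _⟩
        ⟨le_rfl, Real.pi_pos.le⟩ hc
      rw [sub_eq_zero.1 (norm_eq_zero.1 this), hψ]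
  refine HalfPants.eq_of_cosh_eq_cosh dist_nonneg (add_nonneg dist_nonneg hs.1) ?_
  have d2 := hd _ hxm s hs φ (φ + (Real.pi : ℝ))
  rw [hxφ, sub_add_cancel_left, norm_neg, addCircle_two_pi_norm_pi, Real.cos_pi] at d2
  rw [d2, Real.cosh_add]
  ring

namespace HalfPants
variable (P : HalfPants)

/-! ### The half-pants inside the surface -/

theorem dist_deck_deck (n : ℤ) (z w : ℍ) : dist (P.deck n z) (P.deck n w) = dist z w := by
  refine eq_of_cosh_eq_cosh dist_nonneg dist_nonneg ?_
  have h2 : P.factor ^ n ≠ 0 := (zpow_pos P.factor_pos n).ne'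
  rw [P.cosh_dist_eq, P.cosh_dist_eq]
  simp only [coordU_deck, coordV_deck, coordW_deck]
  field_simp

theorem cuffLength_le_dist_deck {n : ℤ} (hn : n ≠ 0) (z : ℍ) :
    P.cuffLength ≤ dist z (P.deck n z) := by
  refine le_trans ?_ (UpperHalfPlane.dist_log_im_le z (P.deck n z))
  rw [deck_im, Real.log_mul (Real.exp_pos _).ne' z.im_pos.ne', Real.log_exp, Real.dist_eq,
    sub_add_cancel_right, abs_neg, abs_mul, abs_of_pos P.cuffLength_pos]
  have : (1 : ℝ) ≤ |(n : ℝ)| := by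
    rw [← Int.cast_abs]
    exact_mod_cast Int.one_le_abs hn
  nlinarith [P.cuffLength_pos]

theorem isClosed_coverSet : IsClosed P.coverSet := by
  have h1 := UpperHalfPlane.continuous_re
  have h2 := UpperHalfPlane.continuous_im
  have e : P.coverSet = {z : ℍ | 0 ≤ z.re} ∩
      ⋂ n : ℤ, {z : ℍ | 0 ≤ sideOf (P.deck n P.apex) (P.deck (n + 1) P.apex) z} := by
    ext z; simp [coverSet]
  rw [e]
  refine (isClosed_le continuous_const h1).inter (isClosed_iInter fun n =>
    isClosed_le continuous_const ?_)
  have h3 := Complex.continuous_normSq.comp UpperHalfPlane.continuous_coe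
  exact (continuous_const.mul (h3.sub continuous_const)).sub
    ((h1.sub continuous_const).mul continuous_const)

theorem continuous_coordV : Continuous P.coordV :=
  continuous_const.div UpperHalfPlane.continuous_im fun z => z.im_pos.ne'

/-- The cover is contained in the region between the cuff and the equidistant curve through the
apex. -/
theorem coordW_le_of_mem {z : ℍ} (hz : z ∈ P.coverSet) : coordW z ≤ P.apexW := by
  rw [mem_coverSet_iff] at hz
  obtain ⟨h0, hz⟩ := hz
  have hU := P.coordU_pos z
  have hV := P.coordV_pos z
  have hUV := P.coordU_mul_coordV z
  obtain ⟨m, hm, hmU⟩ : ∃ m : ℝ, 0 < m ∧ m ^ 2 * P.coordV z = P.coordU z :=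
    ⟨√(P.coordU z / P.coordV z), Real.sqrt_pos.2 (by positivity), by
      rw [Real.sq_sqrt (by positivity)]; field_simp⟩
  obtain ⟨n, hn1, hn2⟩ := exists_mem_Ico_zpow hm P.one_lt_factor
  have h1 := hz n
  have hk := zpow_pos P.factor_pos n
  generalize P.factor ^ n = k at *
  generalize P.factor ^ (n + 1) = k' at *
  rw [← hmU] at h1 hUV
  generalize P.coordV z = V at *
  generalize coordW z = W at *
  have h2 : P.apexC * W ≤ P.apexW * (m * V) := by
    refine le_of_mul_le_mul_left ?_ (by linarith : 0 < k + k')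
    have h3 := mul_nonneg (mul_nonneg P.apexW_pos.le hV.le)
      (mul_nonneg (sub_nonneg.2 hn1) (sub_nonneg.2 hn2.le))
    linear_combination h1 + h3
  have h3 : (P.apexC * W) ^ 2 ≤ (P.apexW * (m * V)) ^ 2 :=
    pow_le_pow_left₀ (mul_nonneg P.apexC_pos.le h0) h2 2
  refine le_of_sq_le_sq ?_ P.apexW_pos.le
  linear_combination h3 - W ^ 2 * P.apexC_sq + P.apexW ^ 2 * hUV

/-- A compact part of the cover that contains a translate of each of its points. -/
def fundamentalDomain : Set ℍ := P.coverSet ∩ {z | P.coordV z ∈ Set.Icc 1 P.factor}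

theorem isCompact_fundamentalDomain : IsCompact P.fundamentalDomain := by
  refine (isCompact_closedBall P.apex (P.apexC * (P.apexC ^ 2 + P.factor))).of_isClosed_subset
    (P.isClosed_coverSet.inter (isClosed_Icc.preimage P.continuous_coordV)) ?_
  rintro z ⟨hz, hV1, hV2⟩
  rw [Metric.mem_closedBall]
  have h1 := P.cosh_dist_eq z P.apex
  have h2 := P.coordW_le_of_mem hz
  have h3 := ((P.mem_coverSet_iff z).1 hz).1
  have h4 := P.coordU_mul_coordV z
  have h5 : P.coordU z ≤ P.apexC ^ 2 := by
    rw [P.apexC_sq]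
    nlinarith [P.coordU_pos z]
  have h6 : dist z P.apex + 1 ≤ 2 * Real.cosh (dist z P.apex) := by
    rw [Real.cosh_eq]
    linarith [Real.add_one_le_exp (dist z P.apex), Real.exp_pos (-dist z P.apex)]
  rw [coordU_apex, coordV_apex, coordW_apex] at h1
  have h7 := mul_nonneg h3 P.apexW_pos.le
  nlinarith [P.apexC_pos]

theorem exists_deck_mem_fundamentalDomain {z : ℍ} (hz : z ∈ P.coverSet) :
    ∃ n : ℤ, P.deck n z ∈ P.fundamentalDomain := by
  obtain ⟨n, hn1, hn2⟩ := exists_mem_Ico_zpow (P.coordV_pos z) P.one_lt_factor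
  refine ⟨n, P.coverSet_deck hz n, ?_⟩
  have hk := zpow_pos P.factor_pos n
  rw [zpow_add_one₀ P.factor_pos.ne'] at hn2
  change P.coordV (P.deck n z) ∈ Set.Icc 1 P.factor
  rw [coordV_deck]
  exact ⟨(one_le_div₀ hk).2 hn1, (div_le_iff₀ hk).2 (by linarith)⟩

variable {S : Type*} (ι : P.Carrier → S)

open Classical in
/-- The covering projection followed by the embedding, as a map from the hyperbolic plane to the
surface; its value outside the cover is irrelevant. -/
noncomputable def toSurface (z : ℍ) : S :=
  if h : z ∈ P.coverSet then ι (P.proj ⟨z, h⟩) else ι P.conePoint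

variable {ι}

theorem toSurface_of_mem {z : ℍ} (h : z ∈ P.coverSet) :
    P.toSurface ι z = ι (P.proj ⟨z, h⟩) := dif_pos h

theorem toSurface_apex : P.toSurface ι P.apex = ι P.conePoint := P.toSurface_of_mem P.apex_mem

theorem mem_range_iff {x : S} : x ∈ Set.range ι ↔ ∃ z ∈ P.coverSet, P.toSurface ι z = x := by
  constructor
  · rintro ⟨c, rfl⟩
    induction c using Quotient.inductionOn with
    | h z => exact ⟨z, z.2, P.toSurface_of_mem z.2⟩
  · rintro ⟨z, hz, rfl⟩
    rw [P.toSurface_of_mem hz]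
    exact Set.mem_range_self _

theorem toSurface_deck {z : ℍ} (hz : z ∈ P.coverSet) (n : ℤ) :
    P.toSurface ι (P.deck n z) = P.toSurface ι z := by
  rw [P.toSurface_of_mem hz, P.toSurface_of_mem (P.coverSet_deck hz n)]
  exact congrArg ι (P.proj_eq_proj_iff.2 ⟨n, rfl⟩).symm

theorem proj_ne_conePoint {z : ℍ} (hz : z ∈ P.coverSet) (hv : ∀ n : ℤ, z ≠ P.deck n P.apex) :
    P.proj ⟨z, hz⟩ ≠ P.conePoint := by
  intro e
  obtain ⟨n, hn⟩ := P.proj_eq_proj_iff.1 e.symm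
  exact hv n hn

variable [MetricSpace S]

theorem toSurface_eq_iff (hι : P.IsEmbedding ι) {z w : ℍ} (hz : z ∈ P.coverSet)
    (hw : w ∈ P.coverSet) :
    P.toSurface ι z = P.toSurface ι w ↔ ∃ n : ℤ, w = P.deck n z := by
  rw [P.toSurface_of_mem hz, P.toSurface_of_mem hw, hι.injective.eq_iff, proj_eq_proj_iff]

theorem exists_toSurface_isometric (hι : P.IsEmbedding ι) {z : ℍ} (hz : z ∈ P.coverSet)
    (hv : ∀ n : ℤ, z ≠ P.deck n P.apex) : ∃ ε : ℝ, 0 < ε ∧ ∀ u ∈ P.coverSet, ∀ v ∈ P.coverSet,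
      dist u z < ε → dist v z < ε →
        dist (P.toSurface ι u) (P.toSurface ι v) = dist u v := by
  obtain ⟨ε, hε, h⟩ := hι.isometric ⟨z, hz⟩ (P.proj_ne_conePoint hz hv)
  refine ⟨ε, hε, fun u hu v hv huz hvz => ?_⟩
  rw [P.toSurface_of_mem hu, P.toSurface_of_mem hv]
  exact h ⟨u, hu⟩ huz ⟨v, hv⟩ hvz

theorem exists_toSurface_apex_isometric (hι : P.IsEmbedding ι) : ∃ ε : ℝ, 0 < ε ∧ ∀ u ∈ P.coverSet,
      dist u P.apex < ε → dist (P.toSurface ι P.apex) (P.toSurface ι u) = dist P.apex u := by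
  obtain ⟨ε, hε, h⟩ := hι.isometric_conePoint
  refine ⟨ε, hε, fun u hu huz => ?_⟩
  rw [P.toSurface_of_mem hu, toSurface_apex]
  exact h ⟨u, hu⟩ huz

theorem hasConeAngle_toSurface (hι : P.IsEmbedding ι) {z : ℍ} (hz : z ∈ P.coverSet)
    (hv : ∀ n : ℤ, z ≠ P.deck n P.apex) : HasConeAngle (P.toSurface ι z) (2 * Real.pi) := by
  rw [P.toSurface_of_mem hz]
  exact hι.regular _ (P.proj_ne_conePoint hz hv)

theorem continuousOn_toSurface (hι : P.IsEmbedding ι) :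
    ContinuousOn (P.toSurface ι) P.coverSet := by
  intro z hz
  rw [Metric.continuousWithinAt_iff]
  intro η hη
  by_cases hv : ∀ n : ℤ, z ≠ P.deck n P.apex
  · obtain ⟨ε, hε, h⟩ := P.exists_toSurface_isometric hι hz hv
    refine ⟨min ε η, lt_min hε hη, fun w hw hwz => ?_⟩
    rw [h w hw z hz (hwz.trans_le (min_le_left _ _)) (by rwa [dist_self])]
    exact hwz.trans_le (min_le_right _ _)
  · push Not at hv
    obtain ⟨n, rfl⟩ := hv
    obtain ⟨ε, hε, h⟩ := P.exists_toSurface_apex_isometric hι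
    refine ⟨min ε η, lt_min hε hη, fun w hw hwz => ?_⟩
    have e : dist (P.deck (-n) w) P.apex = dist w (P.deck n P.apex) := by
      rw [← P.dist_deck_deck n, deck_deck, add_neg_cancel, deck_zero]
    rw [P.toSurface_deck P.apex_mem, ← P.toSurface_deck hw (-n), dist_comm,
      h _ (P.coverSet_deck hw _) (by rw [e]; exact hwz.trans_le (min_le_left _ _)), dist_comm, e]
    exact hwz.trans_le (min_le_right _ _)

/-- Points of the half-pants that are close in the surface have lifts that are close. -/
theorem exists_deck_dist_lt (hι : P.IsEmbedding ι) {z : ℍ} (hz : z ∈ P.coverSet) {ε : ℝ}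
    (hε : 0 < ε) :
    ∃ η : ℝ, 0 < η ∧ ∀ w ∈ P.coverSet, dist (P.toSurface ι w) (P.toSurface ι z) < η →
      ∃ n : ℤ, dist (P.deck n w) z < ε := by
  have hcl : IsClosed (⋂ n : ℤ, {w : ℍ | ε ≤ dist (P.deck n w) z}) :=
    isClosed_iInter fun n => isClosed_le continuous_const
      ((Isometry.of_dist_eq (P.dist_deck_deck n)).continuous.dist continuous_const)
  have hK := P.isCompact_fundamentalDomain.inter_right hcl
  have hfar : ∃ η : ℝ, 0 < η ∧ ∀ w ∈ P.fundamentalDomain ∩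
      ⋂ n : ℤ, {w : ℍ | ε ≤ dist (P.deck n w) z}, η ≤ dist (P.toSurface ι w) (P.toSurface ι z) := by
    rcases Set.eq_empty_or_nonempty (P.fundamentalDomain ∩
      ⋂ n : ℤ, {w : ℍ | ε ≤ dist (P.deck n w) z}) with he | hne
    · exact ⟨1, one_pos, by rw [he]; simp⟩
    · obtain ⟨w, hw, hmin⟩ := hK.exists_isMinOn
        (f := fun w => dist (P.toSurface ι w) (P.toSurface ι z)) hne
        (continuous_dist.comp_continuousOn
          (((P.continuousOn_toSurface hι).mono fun x hx => hx.1.1).prodMk continuousOn_const))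
      refine ⟨dist (P.toSurface ι w) (P.toSurface ι z), dist_pos.2 fun e => ?_, hmin⟩
      obtain ⟨n, hn⟩ := (P.toSurface_eq_iff hι hw.1.1 hz).1 e
      have := Set.mem_iInter.1 hw.2 n
      rw [Set.mem_ofPred_eq, ← hn, dist_self] at this
      linarith
  obtain ⟨η, hη, h⟩ := hfar
  refine ⟨η, hη, fun w hw hwz => ?_⟩
  obtain ⟨m, hm⟩ := P.exists_deck_mem_fundamentalDomain hw
  by_contra! hcon
  have := h _ ⟨hm, Set.mem_iInter.2 fun n => by
    rw [Set.mem_ofPred_eq, deck_deck]; exact hcon _⟩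
  rw [P.toSurface_deck hw] at this
  linarith

end HalfPants

/-! ### Geodesics in the surface and in the cover -/

theorem IsGeodesicOn.continuousOn {S : Type*} [MetricSpace S] {α : ℝ → S} {I : Set ℝ}
    (h : IsGeodesicOn α I) : ContinuousOn α I := by
  intro t ht
  obtain ⟨δ, hδ, hd⟩ := h t ht
  rw [Metric.continuousWithinAt_iff]
  intro ε hε
  refine ⟨min δ ε, lt_min hδ hε, fun s hs hst => ?_⟩
  rw [Real.dist_eq] at hst
  rw [hd s hs t ht (hst.trans_le (min_le_left _ _)) (by rwa [sub_self, abs_zero])]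
  exact hst.trans_le (min_le_right _ _)

theorem IsGeodesicRayFrom.isGeodesicOn_Icc {S : Type*} [MetricSpace S] {α : ℝ → S} {I : Set ℝ}
    {p : S} (hα : IsGeodesicRayFrom α I p) {t : ℝ} (ht : t ∈ I) :
    IsGeodesicOn α (Set.Icc 0 t) := by
  intro s hs
  have hsub := hα.ordConnected.out hα.zero_mem ht
  obtain ⟨e, he, hd⟩ := hα.geodesic s (hsub hs)
  exact ⟨e, he, fun u hu v hv => hd u (hsub hu) v (hsub hv)⟩

/-- A curve that is isometric near each of its times does not increase distances. -/
theorem IsGeodesicOn.dist_le {S : Type*} [MetricSpace S] {α : ℝ → S} {a b : ℝ} (hab : a ≤ b)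
    (h : IsGeodesicOn α (Set.Icc a b)) : dist (α a) (α b) ≤ b - a := by
  have hsub : Set.Icc a b ⊆ {t | dist (α a) (α t) ≤ t - a} := by
    refine IsClosed.Icc_subset_of_forall_mem_nhdsWithin ?_ (by simp) fun t ht => ?_
    · rw [Set.inter_comm]
      exact isClosed_Icc.isClosed_le
        (continuous_dist.comp_continuousOn (continuousOn_const.prodMk h.continuousOn))
        (continuousOn_id.sub continuousOn_const)
    · obtain ⟨δ, hδ, hd⟩ := h t ⟨ht.2.1, ht.2.2.le⟩
      filter_upwards [Ioo_mem_nhdsGT (show t < min (t + δ) b from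
        lt_min (by linarith) ht.2.2)] with s hs
      have hs2 := lt_min_iff.1 hs.2
      have h1 := hd t ⟨ht.2.1, ht.2.2.le⟩ s ⟨ht.2.1.trans hs.1.le, hs2.2.le⟩
        (by rwa [sub_self, abs_zero]) (by rw [abs_of_pos (sub_pos.2 hs.1)]; linarith)
      rw [abs_sub_comm, abs_of_pos (sub_pos.2 hs.1)] at h1
      have h2 : dist (α a) (α t) ≤ t - a := ht.1
      change dist (α a) (α s) ≤ s - a
      linarith [dist_triangle (α a) (α t) (α s)]
  exact hsub ⟨hab, le_rfl⟩

namespace HalfPants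
variable (P : HalfPants) {S : Type*} [MetricSpace S] {ι : P.Carrier → S}

/-- A geodesic launched from the cone point that stays for a while in the half-pants lifts to a ray
from the apex. -/
theorem exists_ray_lift (hι : P.IsEmbedding ι) {α : ℝ → S} {t₀ : ℝ} (ht₀ : 0 < t₀)
    (hα : IsGeodesicOn α (Set.Icc 0 t₀)) (h0 : α 0 = ι P.conePoint)
    (hr : ∀ s ∈ Set.Icc 0 t₀, α s ∈ Set.range ι) :
    ∃ δ : ℝ, 0 < δ ∧ δ ≤ t₀ ∧ ∃ (p r : ℝ) (h : p ^ 2 + r ^ 2 = 1), ∀ s ∈ Set.Icc 0 δ,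
      P.ray h s ∈ P.coverSet ∧ α s = P.toSurface ι (P.ray h s) := by
  rw [← P.toSurface_apex (ι := ι)] at h0
  obtain ⟨ε₁, hε₁, hcone⟩ := P.exists_toSurface_apex_isometric hι
  have hl := P.cuffLength_pos
  obtain ⟨η, hη, hlift⟩ := P.exists_deck_dist_lt hι P.apex_mem
    (lt_min hε₁ (show 0 < P.cuffLength / 3 by positivity))
  obtain ⟨δ₀, hδ₀, hgeo⟩ := hα 0 ⟨le_rfl, ht₀.le⟩
  obtain ⟨δ, hδ, hδη⟩ : ∃ δ : ℝ, 0 < δ ∧ δ < min η (min δ₀ t₀) :=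
    exists_between (lt_min hη (lt_min hδ₀ ht₀))
  simp only [lt_min_iff] at hδη
  obtain ⟨hδη, hδδ₀, hδt₀⟩ := hδη
  have hmem : ∀ s ∈ Set.Icc 0 δ, s ∈ Set.Icc 0 t₀ := fun s hs => ⟨hs.1, hs.2.trans hδt₀.le⟩
  have hdist0 : ∀ s ∈ Set.Icc 0 δ, dist (α 0) (α s) = s := by
    intro s hs
    rw [hgeo 0 ⟨le_rfl, ht₀.le⟩ s (hmem s hs) (by simpa using hδ₀)
      (by rw [sub_zero, abs_of_nonneg hs.1]; linarith [hs.2]), zero_sub, abs_neg,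
      abs_of_nonneg hs.1]
  have hex : ∀ s, ∃ w, s ∈ Set.Icc 0 δ → w ∈ P.coverSet ∧ α s = P.toSurface ι w ∧
      dist w P.apex < P.cuffLength / 3 ∧ dist P.apex w = s := by
    intro s
    by_cases hs : s ∈ Set.Icc 0 δ
    · obtain ⟨w, hw, hws⟩ := P.mem_range_iff.1 (hr s (hmem s hs))
      obtain ⟨n, hn⟩ := hlift w hw (by
        rw [hws, ← h0, dist_comm, hdist0 s hs]; linarith [hs.2])
      rw [lt_min_iff] at hn
      refine ⟨P.deck n w, fun _ => ⟨P.coverSet_deck hw n, ?_, hn.2, ?_⟩⟩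
      · rw [P.toSurface_deck hw, hws]
      · rw [← hcone _ (P.coverSet_deck hw n) hn.1, P.toSurface_deck hw, hws, ← h0, hdist0 s hs]
    · exact ⟨P.apex, fun h => absurd h hs⟩
  choose β hβ using hex
  have hβ0 : β 0 = P.apex := by
    have := (hβ 0 ⟨le_rfl, hδ.le⟩).2.2.2
    exact (dist_eq_zero.1 this).symm
  -- away from the apex, the lifts form a local geodesic
  have hloc : ∀ a, 0 < a → IsGeodesicOn β (Set.Icc a δ) := by
    intro a ha s hs
    have hs' : s ∈ Set.Icc 0 δ := ⟨ha.le.trans hs.1, hs.2⟩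
    obtain ⟨hb1, hb2, hb3, hb4⟩ := hβ s hs'
    have hv : ∀ n : ℤ, β s ≠ P.deck n P.apex := by
      intro n hn
      by_cases hn0 : n = 0
      · rw [hn0, deck_zero] at hn
        rw [hn, dist_self] at hb4
        linarith [hs.1]
      · have := P.cuffLength_le_dist_deck hn0 P.apex
        rw [← hn, dist_comm] at this
        linarith
    obtain ⟨ε₂, hε₂, hiso⟩ := P.exists_toSurface_isometric hι hb1 hv
    obtain ⟨η₂, hη₂, hlift₂⟩ := P.exists_deck_dist_lt hι hb1
      (lt_min hε₂ (show 0 < P.cuffLength / 3 by positivity))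
    obtain ⟨δ₂, hδ₂, hgeo₂⟩ := hα s (hmem s hs')
    have hclose : ∀ u ∈ Set.Icc a δ, |u - s| < min δ₂ η₂ → dist (β u) (β s) < ε₂ := by
      intro u hu hus
      rw [lt_min_iff] at hus
      have hu' : u ∈ Set.Icc 0 δ := ⟨ha.le.trans hu.1, hu.2⟩
      obtain ⟨hc1, hc2, hc3, hc4⟩ := hβ u hu'
      obtain ⟨n, hn⟩ := hlift₂ (β u) hc1 (by
        rw [← hc2, ← hb2, hgeo₂ u (hmem u hu') s (hmem s hs') hus.1 (by simpa using hδ₂)]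
        exact hus.2)
      rw [lt_min_iff] at hn
      have hn0 : n = 0 := by
        by_contra hne
        have h1 := P.cuffLength_le_dist_deck hne (β u)
        have h2 := dist_triangle (β u) P.apex (P.deck n (β u))
        have h3 := dist_triangle P.apex (β s) (P.deck n (β u))
        have h4 := hn.2
        rw [dist_comm] at h4 hb3
        linarith
      rw [hn0, deck_zero] at hn
      exact hn.1
    refine ⟨min δ₂ η₂, lt_min hδ₂ hη₂, fun u hu v hv hus hvs => ?_⟩
    have hu' : u ∈ Set.Icc 0 δ := ⟨ha.le.trans hu.1, hu.2⟩
    have hv' : v ∈ Set.Icc 0 δ := ⟨ha.le.trans hv.1, hv.2⟩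
    rw [← hiso _ (hβ u hu').1 _ (hβ v hv').1 (hclose u hu hus) (hclose v hv hvs),
      ← (hβ u hu').2.1, ← (hβ v hv').2.1]
    exact hgeo₂ u (hmem u hu') v (hmem v hv') (hus.trans_le (min_le_left _ _))
      (hvs.trans_le (min_le_left _ _))
  have hiso : ∀ s ∈ Set.Icc 0 δ, ∀ t ∈ Set.Icc 0 δ, s ≤ t → dist (β s) (β t) = |s - t| := by
    intro s hs t ht hst
    rw [abs_sub_comm, abs_of_nonneg (sub_nonneg.2 hst)]
    have d1 := (hβ s hs).2.2.2
    have d2 := (hβ t ht).2.2.2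
    refine le_antisymm ?_ (by linarith [dist_triangle P.apex (β s) (β t)])
    rcases hs.1.eq_or_lt with h0' | hpos
    · rw [← h0', hβ0, d2, sub_zero]
    · refine IsGeodesicOn.dist_le hst fun u hu => ?_
      obtain ⟨e, he, hd⟩ := hloc s hpos u ⟨hu.1, hu.2.trans ht.2⟩
      exact ⟨e, he, fun x hx y hy => hd x ⟨hx.1, hx.2.trans ht.2⟩ y ⟨hy.1, hy.2.trans ht.2⟩⟩
  obtain ⟨p, r, h, hray⟩ := P.exists_eqOn_ray hδ hβ0 fun s hs t ht => by
    rcases le_total s t with hst | hst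
    · exact hiso s hs t ht hst
    · rw [dist_comm, abs_sub_comm]; exact hiso t ht s hs hst
  refine ⟨δ, hδ, hδt₀.le, p, r, h, fun s hs => ?_⟩
  rw [← hray hs]
  exact ⟨(hβ s hs).1, (hβ s hs).2.1⟩

variable {p r : ℝ} (h : p ^ 2 + r ^ 2 = 1)

theorem ne_deck_apex_of_coordW_lt {z : ℍ} (hz : coordW z < P.apexW) (n : ℤ) :
    z ≠ P.deck n P.apex := by
  rintro rfl
  rw [coordW_deck, coordW_apex] at hz
  exact lt_irrefl _ hz

/-- The image of a ray in the surface is isometric near the times at which it is in the cover and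
not at a vertex. -/
theorem exists_dist_toSurface_ray (hι : P.IsEmbedding ι) {T t : ℝ} (ht : t ∈ Set.Icc 0 T)
    (hT : P.ray h T ∈ P.coverSet) (hW : coordW (P.ray h t) < P.apexW) :
    ∃ ε : ℝ, 0 < ε ∧ ∀ s ∈ Set.Icc 0 T, ∀ u ∈ Set.Icc 0 T, |s - t| < ε → |u - t| < ε →
      dist (P.toSurface ι (P.ray h s)) (P.toSurface ι (P.ray h u)) = |s - u| := by
  have hm : ∀ s ∈ Set.Icc 0 T, P.ray h s ∈ P.coverSet :=
    fun s hs => P.ray_mem_coverSet h hs.1 hs.2 hT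
  obtain ⟨ε, hε, hiso⟩ := P.exists_toSurface_isometric hι (hm t ht)
    (P.ne_deck_apex_of_coordW_lt hW)
  refine ⟨ε, hε, fun s hs u hu hst hut => ?_⟩
  rw [hiso _ (hm s hs) _ (hm u hu) (by rwa [dist_ray]) (by rwa [dist_ray]), dist_ray]

/-- A geodesic in the surface that starts along the image of a ray follows it as long as the ray
stays in the cover and does not meet a vertex. -/
theorem eqOn_toSurface_ray (hι : P.IsEmbedding ι) {α : ℝ → S} {T δ : ℝ} (hδ : 0 < δ)
    (hα : IsGeodesicOn α (Set.Icc 0 T)) (hT : P.ray h T ∈ P.coverSet)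
    (hW : ∀ t ∈ Set.Ioo 0 T, coordW (P.ray h t) < P.apexW)
    (heq : ∀ s ∈ Set.Icc 0 δ, α s = P.toSurface ι (P.ray h s)) :
    ∀ t ∈ Set.Icc 0 T, α t = P.toSurface ι (P.ray h t) := by
  rcases le_total T δ with hTδ | hTδ
  · exact fun t ht => heq t ⟨ht.1, ht.2.trans hTδ⟩
  have hm : ∀ s ∈ Set.Icc 0 T, P.ray h s ∈ P.coverSet :=
    fun s hs => P.ray_mem_coverSet h hs.1 hs.2 hT
  have hcont : ContinuousOn (fun t => P.toSurface ι (P.ray h t)) (Set.Icc 0 T) :=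
    (P.continuousOn_toSurface hι).comp (P.continuous_ray h).continuousOn hm
  have hcl : IsClosed {t | t ∈ Set.Icc 0 T ∧ α t = P.toSurface ι (P.ray h t)} := by
    have h1 : ContinuousOn (fun t => dist (α t) (P.toSurface ι (P.ray h t))) (Set.Icc 0 T) :=
      continuous_dist.comp_continuousOn (hα.continuousOn.prodMk hcont)
    have h2 := h1.preimage_isClosed_of_isClosed isClosed_Icc (isClosed_singleton (x := (0 : ℝ)))
    convert h2 using 1
    ext t
    simp [dist_eq_zero]
  by_contra! hcon
  obtain ⟨t₁, ht₁, hne⟩ := hcon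
  -- the supremum of the times up to which the two curves agree
  let A : Set ℝ := {t | t ∈ Set.Icc 0 T ∧ ∀ s ∈ Set.Icc 0 t, α s = P.toSurface ι (P.ray h s)}
  have hA0 : δ ∈ A := ⟨⟨hδ.le, hTδ⟩, heq⟩
  have hAb : BddAbove A := ⟨T, fun t ht => ht.1.2⟩
  set m := sSup A with hmdef
  have hδm : δ ≤ m := le_csSup hAb hA0
  have hmT : m ≤ T := csSup_le ⟨δ, hA0⟩ fun t ht => ht.1.2
  have hmI : m ∈ Set.Icc 0 T := ⟨hδ.le.trans hδm, hmT⟩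
  have hlt : ∀ s, 0 ≤ s → s < m → α s = P.toSurface ι (P.ray h s) := by
    intro s hs hsm
    obtain ⟨t, ht, hst⟩ := exists_lt_of_lt_csSup ⟨δ, hA0⟩ hsm
    exact ht.2 s ⟨hs, hst.le⟩
  have hmeq : α m = P.toSurface ι (P.ray h m) := by
    have hmcl : m ∈ closure {t | t ∈ Set.Icc 0 T ∧ α t = P.toSurface ι (P.ray h t)} := by
      refine closure_mono ?_ (csSup_mem_closure ⟨δ, hA0⟩ hAb)
      exact fun t ht => ⟨ht.1, ht.2 t ⟨ht.1.1, le_rfl⟩⟩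
    exact (hcl.closure_eq ▸ hmcl).2
  have hle : ∀ s ∈ Set.Icc 0 m, α s = P.toSurface ι (P.ray h s) := by
    intro s hs
    rcases hs.2.eq_or_lt with rfl | hs2
    · exact hmeq
    · exact hlt s hs.1 hs2
  have hmT' : m < T := by
    refine lt_of_le_of_ne hmT fun e => hne (hle t₁ ⟨ht₁.1, ?_⟩)
    rw [e]; exact ht₁.2
  have hm0 : 0 < m := hδ.trans_le hδm
  have hWm := hW m ⟨hm0, hmT'⟩
  obtain ⟨ε₁, hε₁, hd₁⟩ := P.exists_dist_toSurface_ray h hι hmI hT hWm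
  obtain ⟨ε₂, hε₂, hd₂⟩ := hα m hmI
  obtain ⟨ε₃, hε₃, hu⟩ := (P.hasConeAngle_toSurface hι (hm m hmI)
    (P.ne_deck_apex_of_coordW_lt hWm)).exists_unique_continuation
  obtain ⟨e, he, hemin⟩ : ∃ e : ℝ, 0 < e ∧
      e < min (min ε₁ ε₂) (min ε₃ (min m (T - m))) :=
    exists_between (lt_min (lt_min hε₁ hε₂) (lt_min hε₃ (lt_min hm0 (sub_pos.2 hmT'))))
  simp only [lt_min_iff] at hemin
  obtain ⟨⟨he1, he2⟩, he3, he4, he5⟩ := hemin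
  have hstep : m + e ∈ A := by
    refine ⟨⟨by linarith, by linarith⟩, fun s hs => ?_⟩
    rcases le_or_gt s m with hsm | hsm
    · exact hle s ⟨hs.1, hsm⟩
    have qI : m - e ∈ Set.Icc 0 T := ⟨by linarith, by linarith⟩
    have sI : s ∈ Set.Icc 0 T := ⟨hs.1, by linarith [hs.2]⟩
    have hqe := hle (m - e) ⟨by linarith, by linarith⟩
    have aq : |m - e - m| = e := by rw [sub_sub_cancel_left, abs_neg, abs_of_pos he]
    have as : |s - m| = s - m := abs_of_pos (by linarith)
    have aqs : |m - e - s| = e + (s - m) := by rw [abs_sub_comm, abs_of_pos (by linarith)]; ring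
    have am : |m - m| = 0 := by rw [sub_self, abs_zero]
    have dq1 := hd₁ _ qI _ hmI (by linarith) (by linarith)
    have ds1 := hd₁ _ sI _ hmI (by linarith [hs.2]) (by linarith)
    have dqs1 := hd₁ _ qI _ sI (by linarith) (by linarith [hs.2])
    have ds2 := hd₂ _ sI _ hmI (by linarith [hs.2]) (by linarith)
    have dqs2 := hd₂ _ qI _ sI (by linarith) (by linarith [hs.2])
    rw [hqe] at dqs2
    rw [hmeq] at ds2
    rw [aq] at dq1
    rw [as] at ds1 ds2
    rw [aqs] at dqs1 dqs2
    exact hu _ _ _ (by rw [dq1]; exact he) (by rw [dq1]; exact he3)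
      (by rw [ds2]; linarith [hs.2]) (by rw [ds1, ds2]) (by rw [dq1, ds2, dqs2])
      (by rw [dq1, ds1, dqs1])
  linarith [le_csSup hAb hstep]

end HalfPants

namespace HalfPants
variable (P : HalfPants) {S : Type*} [MetricSpace S] {ι : P.Carrier → S}
  {p r : ℝ} (h : p ^ 2 + r ^ 2 = 1)

/-! ### Rays launched within the spiral-angle -/

/-- The two directions with `r * apexC = -apexW` are those of the two spiral rays. -/
theorem ray_mem_of_spiral (hr : -P.apexW = r * P.apexC) {t : ℝ} (ht : 0 ≤ t) :
    P.ray h t ∈ P.coverSet ∧ coordW (P.ray h t) = P.apexW * Real.exp (-t) := by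
  have hc := P.apexC_pos
  have hW : coordW (P.ray P.spiral_direction t) = coordW (P.ray h t) := by
    rw [coordW_ray, coordW_ray, ← hr]
    field_simp
  refine ⟨?_, by rw [← hW, coordW_spiral]⟩
  have hr' : r = -(P.apexW / P.apexC) := by field_simp; linarith
  have hp : p ^ 2 = (1 / P.apexC) ^ 2 := by
    have := P.spiral_direction
    rw [← hr'] at this
    linarith
  have hm := P.spiral_mem_coverSet ht
  rcases sq_eq_sq_iff_eq_or_eq_neg.1 hp with hp | hp
  · subst hp hr'; exact hm
  · subst hp hr'
    obtain ⟨e1, e2⟩ := P.ray_neg_slope P.spiral_direction t h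
    exact P.coverSet_congr_swap e1 e2 hW hm

theorem segment_subset_of_launched (hι : P.IsEmbedding ι) {α : ℝ → S} {I : Set ℝ}
    (hα : IsGeodesicRayFrom α I (ι P.conePoint)) (hL : P.LaunchedWithinSpiralAngle ι α I) :
    segmentToFirstSelfIntersection α I ⊆ Set.range ι := by
  obtain ⟨δ, hδ, hδI, β, hβ0, hβ, hαβ, σ, hσ, hle⟩ := hL
  obtain ⟨p, r, h, hray⟩ := P.exists_eqOn_ray (β := fun s => (β s : ℍ)) hδ
    (by rw [hβ0]; rfl) hβ
  have hδδ : δ ∈ Set.Icc 0 δ := ⟨hδ.le, le_rfl⟩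
  have hm : P.ray h δ ∈ P.coverSet := by rw [← hray hδδ]; exact (β δ).2
  have heq : ∀ s ∈ Set.Icc 0 δ, α s = P.toSurface ι (P.ray h s) := by
    intro s hs
    rw [hαβ s hs, ← hray hs, P.toSurface_of_mem (β s).2]
  rw [show (β δ : ℍ) = _ from hray hδδ] at hle
  have hr := P.neg_apexW_le_of_zipperAngle_le h hσ hδ hm hle
  rintro x ⟨t, ht, hinj, rfl⟩
  have ht0 : 0 ≤ t := hα.nonneg ht
  rw [P.mem_range_iff]
  rcases hr.eq_or_lt with hr | hr
  · have hmt := (P.ray_mem_of_spiral h hr ht0).1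
    refine ⟨_, hmt, (P.eqOn_toSurface_ray h hι hδ (hα.isGeodesicOn_Icc ht) hmt (fun s hs => ?_)
      heq t ⟨ht0, le_rfl⟩).symm⟩
    rw [(P.ray_mem_of_spiral h hr hs.1.le).2]
    exact mul_lt_of_lt_one_right P.apexW_pos (Real.exp_lt_one_iff.2 (by linarith [hs.1]))
  · obtain ⟨s, u, hu, hus, hms, hlt, n, hn⟩ := P.exists_self_intersection h hr hδ hm
    rcases le_or_gt t s with hts | hts
    · have hmt := P.ray_mem_coverSet h ht0 hts hms
      exact ⟨_, hmt, (P.eqOn_toSurface_ray h hι hδ (hα.isGeodesicOn_Icc ht) hmt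
        (fun τ hτ => hlt τ ⟨hτ.1, hτ.2.trans_le hts⟩) heq t ⟨ht0, le_rfl⟩).symm⟩
    · -- the ray has already met itself at time `s`
      exfalso
      have hsI : s ∈ I := hα.ordConnected.out hα.zero_mem ht ⟨hu.trans hus.le, hts.le⟩
      have hE := P.eqOn_toSurface_ray h hι hδ (hα.isGeodesicOn_Icc hsI) hms hlt heq
      have e : α s = α u := by
        rw [hE s ⟨hu.trans hus.le, le_rfl⟩, hE u ⟨hu, hus.le⟩, hn,
          P.toSurface_deck (P.ray_mem_coverSet h hu hus.le hms)]
      have := hinj ⟨hu.trans hus.le, hts⟩ ⟨hu, hus.trans hts⟩ e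
      linarith

/-! ### Rays that cross the cuff -/

/-- A ray that reaches the cuff is not stopped there: the cuff consists of regular points, so it
can be continued. -/
theorem exists_mem_gt_of_hits_cuff (hι : P.IsEmbedding ι) {α : ℝ → S} {I : Set ℝ}
    (hα : IsGeodesicRayFrom α I (ι P.conePoint)) {δ T : ℝ} (hδ : 0 < δ) (hδI : Set.Icc 0 δ ⊆ I)
    (hT : 0 < T) (hTm : P.ray h T ∈ P.coverSet)
    (hW : ∀ t ∈ Set.Ioc 0 T, coordW (P.ray h t) < P.apexW)
    (heq : ∀ t ∈ I, t ≤ T → α t = P.toSurface ι (P.ray h t)) : ∃ t ∈ I, T < t := by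
  by_contra! hI
  have hTT : T ∈ Set.Icc 0 T := ⟨hT.le, le_rfl⟩
  have hWT := hW T ⟨hT, le_rfl⟩
  obtain ⟨ε₁, hε₁, hd₁⟩ := P.exists_dist_toSurface_ray h hι hTT hTm hWT
  obtain ⟨ε₂, hε₂, hd₂⟩ := (P.hasConeAngle_toSurface hι hTm
    (P.ne_deck_apex_of_coordW_lt hWT)).exists_continuation
  obtain ⟨η, hη, hηmin⟩ : ∃ η : ℝ, 0 < η ∧ η < min ε₁ (min ε₂ T) :=
    exists_between (lt_min hε₁ (lt_min hε₂ hT))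
  simp only [lt_min_iff] at hηmin
  obtain ⟨hη1, hη2, hηT⟩ := hηmin
  have aT : |T - T| < ε₁ := by rwa [sub_self, abs_zero]
  have dqT : ∀ s, T - η ≤ s → s ≤ T →
      dist (P.toSurface ι (P.ray h s)) (P.toSurface ι (P.ray h T)) = T - s := by
    intro s h1 h2
    rw [hd₁ s ⟨by linarith, h2⟩ T hTT (by rw [abs_sub_comm, abs_of_nonneg] <;> linarith) aT,
      abs_sub_comm, abs_of_nonneg (by linarith)]
  have dq := dqT (T - η) le_rfl (by linarith)
  rw [sub_sub_cancel] at dq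
  obtain ⟨g, hg0, hg, hgx⟩ := hd₂ (P.toSurface ι (P.ray h (T - η))) (by rwa [dq]) (by rwa [dq])
  obtain ⟨f, hf1, hf2⟩ : ∃ f : ℝ → S, (∀ t, t ≤ T → f t = P.toSurface ι (P.ray h t)) ∧
      ∀ t, T < t → f t = g (t - T) :=
    ⟨fun t => if t ≤ T then P.toSurface ι (P.ray h t) else g (t - T),
      fun t ht => if_pos ht, fun t ht => if_neg (not_le.2 ht)⟩
  -- near the cuff, the concatenation is isometric
  have hf : ∀ s u, T - η < s → s ≤ u → u ≤ T + η → dist (f s) (f u) = |s - u| := by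
    intro s u hs hsu hu
    rcases le_or_gt u T with huT | huT
    · rw [hf1 s (hsu.trans huT), hf1 u huT]
      exact hd₁ s ⟨by linarith, hsu.trans huT⟩ u ⟨by linarith, huT⟩
        (by rw [abs_sub_comm, abs_of_nonneg] <;> linarith)
        (by rw [abs_sub_comm, abs_of_nonneg] <;> linarith)
    · rcases le_or_gt s T with hsT | hsT
      · rw [hf1 s hsT, hf2 u huT, hgx _ ?_ (u - T) ⟨by linarith, by linarith⟩,
          dqT s hs.le hsT, abs_sub_comm, abs_of_nonneg (by linarith)]
        · ring
        · rw [dq, dqT s hs.le hsT, hd₁ (T - η) ⟨by linarith, by linarith⟩ s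
            ⟨by linarith, hsT⟩ (by rw [abs_sub_comm, abs_of_nonneg] <;> linarith)
            (by rw [abs_sub_comm, abs_of_nonneg] <;> linarith), abs_sub_comm,
            abs_of_nonneg (by linarith)]
          ring
      · rw [hf2 s hsT, hf2 u huT, hg _ ⟨by linarith, by linarith⟩ _ ⟨by linarith, by linarith⟩]
        congr 1
        ring
  have hgeo : IsGeodesicOn f (Set.Icc 0 (T + η)) := by
    intro t ht
    rcases le_or_gt T t with hTt | hTt
    · refine ⟨η, hη, fun s hs u hu hst hut => ?_⟩
      have hs' := abs_lt.1 hst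
      have hu' := abs_lt.1 hut
      rcases le_total s u with hsu | hsu
      · exact hf s u (by linarith) hsu hu.2
      · rw [dist_comm, abs_sub_comm]
        exact hf u s (by linarith) hsu hs.2
    · rcases ht.1.eq_or_lt with rfl | ht0
      · obtain ⟨e, he, hd⟩ := hα.geodesic 0 hα.zero_mem
        refine ⟨min e (min δ T), lt_min he (lt_min hδ hT), fun s hs u hu hst hut => ?_⟩
        simp only [sub_zero, lt_min_iff, abs_of_nonneg hs.1, abs_of_nonneg hu.1] at hst hut
        have hsI : s ∈ I := hδI ⟨hs.1, hst.2.1.le⟩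
        have huI : u ∈ I := hδI ⟨hu.1, hut.2.1.le⟩
        rw [hf1 s hst.2.2.le, hf1 u hut.2.2.le, ← heq s hsI hst.2.2.le, ← heq u huI hut.2.2.le]
        exact hd s hsI u huI (by rw [sub_zero, abs_of_nonneg hs.1]; exact hst.1)
          (by rw [sub_zero, abs_of_nonneg hu.1]; exact hut.1)
      · obtain ⟨e, he, hd⟩ := P.exists_dist_toSurface_ray h hι ⟨ht0.le, hTt.le⟩ hTm
          (hW t ⟨ht0, hTt.le⟩)
        refine ⟨min e (T - t), lt_min he (sub_pos.2 hTt), fun s hs u hu hst hut => ?_⟩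
        rw [lt_min_iff] at hst hut
        have hsT : s ≤ T := by linarith [(abs_lt.1 hst.2).2]
        have huT : u ≤ T := by linarith [(abs_lt.1 hut.2).2]
        rw [hf1 s hsT, hf1 u huT]
        exact hd s ⟨hs.1, hsT⟩ u ⟨hu.1, huT⟩ hst.1 hut.1
  have hmax := hα.maximal f (Set.Icc 0 (T + η)) Set.ordConnected_Icc (fun t ht => ht.1)
    (fun t ht => ⟨hα.nonneg ht, by linarith [hI t ht]⟩)
    (fun t ht => by rw [heq t ht (hI t ht), hf1 t (hI t ht)]) hgeo
  linarith [hI _ (hmax ⟨by linarith, le_rfl⟩)]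

/-- A ray launched outside the spiral-angle regions leaves the half-pants through the cuff before it
meets itself. -/
theorem not_segment_subset_of_hits_cuff (hι : P.IsEmbedding ι) {α : ℝ → S} {I : Set ℝ}
    (hα : IsGeodesicRayFrom α I (ι P.conePoint)) {δ : ℝ} (hδ : 0 < δ) (hδI : Set.Icc 0 δ ⊆ I)
    (heq : ∀ s ∈ Set.Icc 0 δ, α s = P.toSurface ι (P.ray h s)) (hr : r * P.apexC < -P.apexW) :
    ¬ segmentToFirstSelfIntersection α I ⊆ Set.range ι := by
  intro hseg
  obtain ⟨T, hT, hW0, hTm, hanti⟩ := P.exists_ray_hits_cuff h hr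
  have hTT : T ∈ Set.Icc 0 T := ⟨hT.le, le_rfl⟩
  have hm : ∀ s ∈ Set.Icc 0 T, P.ray h s ∈ P.coverSet :=
    fun s hs => P.ray_mem_coverSet h hs.1 hs.2 hTm
  have hWlt : ∀ t ∈ Set.Ioc 0 T, coordW (P.ray h t) < P.apexW := by
    intro t ht
    have := hanti ⟨le_rfl, hT.le⟩ ⟨ht.1.le, ht.2⟩ ht.1
    simpa using this
  have hE : ∀ t ∈ I, t ≤ T → α t = P.toSurface ι (P.ray h t) := by
    intro t ht htT
    have ht0 : 0 ≤ t := hα.nonneg ht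
    exact P.eqOn_toSurface_ray h hι hδ (hα.isGeodesicOn_Icc ht) (hm t ⟨ht0, htT⟩)
      (fun s hs => hWlt s ⟨hs.1, hs.2.le.trans htT⟩) heq t ⟨ht0, le_rfl⟩
  obtain ⟨t₁, ht₁, hTt₁⟩ := P.exists_mem_gt_of_hits_cuff h hι hα hδ hδI hT hTm hWlt hE
  have hIcc : ∀ t, 0 ≤ t → t ≤ t₁ → t ∈ I := fun t h1 h2 =>
    hα.ordConnected.out hα.zero_mem ht₁ ⟨h1, h2⟩
  have hTI := hIcc T hT.le hTt₁.le
  have hET := hE T hTI le_rfl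
  obtain ⟨ε₁, hε₁, hiso⟩ := P.exists_toSurface_isometric hι hTm
    (P.ne_deck_apex_of_coordW_lt (hWlt T ⟨hT, le_rfl⟩))
  obtain ⟨ε₂, hε₂, hlift⟩ := P.exists_deck_dist_lt hι hTm hε₁
  obtain ⟨ε₃, hε₃, hd⟩ := hα.geodesic T hTI
  obtain ⟨e, he, hemin⟩ : ∃ e : ℝ, 0 < e ∧ e < min (min ε₁ ε₂) (min ε₃ (min T (t₁ - T))) :=
    exists_between (lt_min (lt_min hε₁ hε₂) (lt_min hε₃ (lt_min hT (sub_pos.2 hTt₁))))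
  simp only [lt_min_iff] at hemin
  obtain ⟨⟨he1, he2⟩, he3, heT, het⟩ := hemin
  have aT : |T - T| < ε₃ := by rwa [sub_self, abs_zero]
  -- just after crossing the cuff, the ray is outside the half-pants
  have hout : ∀ t, T < t → t ≤ T + e → α t ∉ Set.range ι := by
    intro t hTt hte hmem
    obtain ⟨w, hw, hwt⟩ := P.mem_range_iff.1 hmem
    have htI := hIcc t (by linarith) (by linarith)
    have hqI := hIcc (T - e) (by linarith) (by linarith)
    have hqT : T - e ∈ Set.Icc 0 T := ⟨by linarith, by linarith⟩
    have at' : |t - T| < ε₃ := by rw [abs_of_pos] <;> linarith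
    have aq : |T - e - T| < ε₃ := by rw [sub_sub_cancel_left, abs_neg, abs_of_pos] <;> linarith
    have d1 := hd T hTI t htI aT at'
    have d2 := hd (T - e) hqI t htI aq at'
    rw [abs_sub_comm, abs_of_pos (by linarith)] at d1 d2
    obtain ⟨n, hn⟩ := hlift w hw (by rw [hwt, ← hET, dist_comm, d1]; linarith)
    have hw' := P.coverSet_deck hw n
    have d3 : dist (P.ray h (T - e)) (P.ray h T) = e := by
      rw [dist_ray, sub_sub_cancel_left, abs_neg, abs_of_pos he]
    have d4 := hiso _ hTm _ hw' (by rwa [dist_self]) hn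
    have d5 := hiso _ (hm _ hqT) _ hw' (by rwa [d3]) hn
    rw [P.toSurface_deck hw, hwt, ← hET, d1] at d4
    rw [P.toSurface_deck hw, hwt, ← hE _ hqI hqT.2, d2] at d5
    have e1 := (P.coord_between d3 d4.symm (by rw [← d5]; ring)).2.2
    rw [hW0, mul_zero] at e1
    have h1 : 0 < Real.sinh (t - T) := Real.sinh_pos_iff.2 (by linarith)
    have h2 : 0 < Real.sinh e := Real.sinh_pos_iff.2 he
    have h3 : 0 < coordW (P.ray h (T - e)) := by
      rw [← hW0]
      exact hanti hqT hTT (by linarith)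
    have h4 := ((P.mem_coverSet_iff _).1 hw').1
    nlinarith [mul_pos h1 h3, mul_nonneg h2.le h4]
  have hne : ∀ x y, 0 ≤ x → x < y → y < T + e → α x ≠ α y := by
    intro x y hx hxy hy exy
    have hxI := hIcc x hx (by linarith)
    have hyI := hIcc y (by linarith) (by linarith)
    rcases le_or_gt y T with hyT | hyT
    · rw [hE x hxI (hxy.le.trans hyT), hE y hyI hyT, P.toSurface_eq_iff hι
        (hm x ⟨hx, hxy.le.trans hyT⟩) (hm y ⟨by linarith, hyT⟩)] at exy
      obtain ⟨n, hn⟩ := exy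
      have := hanti ⟨hx, hxy.le.trans hyT⟩ ⟨by linarith, hyT⟩ hxy
      simp only [hn, coordW_deck, lt_self_iff_false] at this
    · rcases le_or_gt x T with hxT | hxT
      · refine hout y hyT hy.le (exy ▸ P.mem_range_iff.2 ⟨_, hm x ⟨hx, hxT⟩, (hE x hxI hxT).symm⟩)
      · have := hd x hxI y hyI (by rw [abs_of_pos] <;> linarith) (by rw [abs_of_pos] <;> linarith)
        rw [exy, dist_self] at this
        have := abs_eq_zero.1 this.symm
        linarith
  refine hout (T + e) (by linarith) le_rfl (hseg ⟨T + e, hIcc _ (by linarith) (by linarith),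
    fun x hx y hy exy => ?_, rfl⟩)
  rcases lt_trichotomy x y with hxy | hxy | hxy
  · exact absurd exy (hne x y hx.1 hxy hy.2)
  · exact hxy
  · exact absurd exy.symm (hne y x hy.1 hxy hx.2)

theorem launched_of_segment_subset (hι : P.IsEmbedding ι) {α : ℝ → S} {I : Set ℝ}
    (hα : IsGeodesicRayFrom α I (ι P.conePoint))
    (hseg : segmentToFirstSelfIntersection α I ⊆ Set.range ι) :
    P.LaunchedWithinSpiralAngle ι α I := by
  obtain ⟨t₁, ht₁, ht₁0⟩ := hα.nontrivial
  obtain ⟨e, he, hd⟩ := hα.geodesic 0 hα.zero_mem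
  obtain ⟨t₀, ht₀, ht₀min⟩ : ∃ t₀ : ℝ, 0 < t₀ ∧ t₀ < min t₁ e := exists_between (lt_min ht₁0 he)
  rw [lt_min_iff] at ht₀min
  have hI : ∀ s ∈ Set.Icc 0 t₀, s ∈ I := fun s hs =>
    hα.ordConnected.out hα.zero_mem ht₁ ⟨hs.1, by linarith [hs.2]⟩
  have hiso : ∀ s ∈ Set.Icc 0 t₀, ∀ u ∈ Set.Icc 0 t₀, dist (α s) (α u) = |s - u| :=
    fun s hs u hu => hd s (hI s hs) u (hI u hu)
      (by rw [sub_zero, abs_of_nonneg hs.1]; linarith [hs.2])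
      (by rw [sub_zero, abs_of_nonneg hu.1]; linarith [hu.2])
  have hrange : ∀ s ∈ Set.Icc 0 t₀, α s ∈ Set.range ι := by
    intro s hs
    refine hseg ⟨s, hI s hs, fun x hx y hy exy => ?_, rfl⟩
    have := hiso x ⟨hx.1, hx.2.le.trans hs.2⟩ y ⟨hy.1, hy.2.le.trans hs.2⟩
    rw [exy, dist_self] at this
    exact sub_eq_zero.1 (abs_eq_zero.1 this.symm)
  obtain ⟨δ, hδ, hδt, p, r, h, hlift⟩ := P.exists_ray_lift hι ht₀
    (fun s _ => ⟨1, one_pos, fun u hu v hv _ _ => hiso u hu v hv⟩) hα.start hrange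
  have hδI : Set.Icc 0 δ ⊆ I := fun s hs => hI s ⟨hs.1, hs.2.trans hδt⟩
  rcases lt_or_ge (r * P.apexC) (-P.apexW) with hr | hr
  · exact absurd hseg (P.not_segment_subset_of_hits_cuff h hι hα hδ hδI
      (fun s hs => (hlift s hs).2) hr)
  have hproj : ∀ s ∈ Set.Icc 0 δ, (Set.projIcc 0 δ hδ.le s : ℝ) = s := fun s hs => by
    rw [Set.projIcc_of_mem hδ.le hs]
  refine ⟨δ, hδ, hδI, fun s => ⟨P.ray h (Set.projIcc 0 δ hδ.le s),
    (hlift _ (Set.projIcc 0 δ hδ.le s).2).1⟩, ?_, fun s hs t ht => ?_, fun s hs => ?_,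
    _, P.exists_isSpiralAngle, ?_⟩
  · apply Subtype.ext
    change P.ray h (Set.projIcc 0 δ hδ.le 0) = P.apex
    rw [hproj 0 ⟨le_rfl, hδ.le⟩, ray_zero]
  · rw [Subtype.dist_eq, dist_ray, hproj s hs, hproj t ht]
  · refine Eq.trans ?_ (P.toSurface_of_mem _)
    rw [hproj s hs]
    exact (hlift s hs).2
  · have hδδ : δ ∈ Set.Icc 0 δ := ⟨hδ.le, le_rfl⟩
    change P.zipperAngle (P.ray h (Set.projIcc 0 δ hδ.le δ)) ≤ _
    rw [hproj δ hδδ, P.zipperAngle_ray_le_iff h P.spiral_direction hδ one_pos (hlift δ hδδ).1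
      (P.spiral_mem_coverSet zero_le_one), ← neg_div, div_le_iff₀ P.apexC_pos]
    exact hr

end HalfPants

theorem mainTheorem7 {S : Type*} [MetricSpace S] (hS : IsHyperbolicConeSurface S)
    (P : HalfPants) (ι : P.Carrier → S) (hι : P.IsEmbedding ι)
    (α : ℝ → S) (I : Set ℝ) (hα : IsGeodesicRayFrom α I (ι P.conePoint)) :
    segmentToFirstSelfIntersection α I ⊆ Set.range ι ↔
      P.LaunchedWithinSpiralAngle ι α I :=
  ⟨P.launched_of_segment_subset hι hα, P.segment_subset_of_launched hι hα⟩
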